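/- Let $n\ge 1$, let $\Omega\subset\mathbb R^n$ be a bounded open set with $C^\infty$ boundary (locally on one side of it), and let $\omega\subset\Omega$ be open and non-empty. Let $a_{ij}=a_{ji}$ and $c$ be real functions, smooth up to $\overline\Omega$, with $\sum_{i,j}a_{ij}(\xi)v_iv_j\ge\alpha|v|^2$ on $\Omega$ for some $\alpha>0$, and let $$Ax=\sum_{i,j}\partial_j(a_{ij}\partial_i x)+c\,x$$ be the associated operator with Dirichlet boundary conditions on $L^2(\Omega)$, with domain $D(A)=\{x\in H^1_0(\Omega): Ax\in L^2(\Omega)\}$. Consider the system $\dot x=Ax+Bu$, $y=Cx$, observed by $q$ sensors, each of one of the following types, where $\sigma$ is surface measure and $\nu$ the outward unit normal on $\partial\Omega$: * zone sensor $(D_i,f_i)$ with $D_i\subset\Omega$ measurable and non-empty and $f_i\in L^2(D_i)$: $(Cx)_i=\langle x,f_i\rangle_{L^2(D_i)}$; * pointwise sensor at $b_i\in\overline\Omega$: $(Cx)_i=x(b_i)$, the value at $b_i$ of the representative of $x$ that is continuous on $\overline\Omega$; * boundary zone sensor $(\Gamma_i,f_i)$ with $\Gamma_i\subset\partial\Omega$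 measurable and non-empty and $f_i\in L^2(\Gamma_i)$: $(Cx)_i=\langle \partial x/\partial\nu,f_i\rangle_{L^2(\Gamma_i,\sigma)}$, the normal derivative being taken in the sense of traces of $H^2$ functions. Assume that these formulas define a linear operator $C:D(A)\to\mathbb R^q$ which is bounded for the graph norm of $A$. Let $\lambda_1,\dots,\lambda_J$ ($J\ge 0$) be all the distinct non-negative eigenvalues of the (self-adjoint) operator $A$, let $r_m$ be the multiplicity of $\lambda_m$, let $\psi_{m1},\dots,\psi_{mr_m}$ be a basis of its eigenspace, and let $r=\max_m r_m$ (with $r=0$ if $J=0$). Assume that for each $m\le J$ the gradients $\nabla\psi_{m1}|_\omega,\dots,\nabla\psi_{mr_m}|_\omega$ are linearly independent. Let $G_m$ be the $q\times r_m$ matrix with entries $$(G_m)_{ij}=\begin{cases}\langle\psi_{mj},f_i\rangle_{L^2(D_i)}&\text{if sensor } i \text{ is a zone sensor},\\ \psi_{mj}(b_i)&\text{if it is pointwise},\\ \langle\partial\psi_{mj}/\partial\nu,f_i\rangle_{L^2(\Gamma_i)}&\text{if it is a boundary zone sensor}.\end{cases}$$ Call the system *asymptotically regionally gradient detectable on $\omega$*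 ($\omega_G$-detectable) if there is a linear operator $H:\mathbb R^q\to L^2(\Omega)$ such that $A-HC$, with domain $D(A)$, generates a strongly continuous semigroup $(S_H(t))_{t\ge0}$ on $L^2(\Omega)$ and, for every $x_0\in H^1(\Omega)$, $\nabla S_H(t)x_0$ exists in $L^2(\omega)^n$ for all $t\ge 0$ and $$\lim_{t\to\infty}\|\nabla S_H(t)x_0\|_{L^2(\omega)^n}=0 .$$ Call it *exponentially* $\omega_G$-detectable if there are such an $H$ and constants $M,\alpha>0$ with $\|\nabla S_H(t)x_0\|_{L^2(\omega)^n}\le Me^{-\alpha t}\|x_0\|_{H^1(\Omega)}$ for all $t\ge0$ and $x_0\in H^1_0(\Omega)$ (in place of the limit condition). Then the system is asymptotically $\omega_G$-detectable if and only if 1. $q\ge r$, and 2. $\operatorname{rank}G_m=r_m$ for all $m=1,\dots,J$; and it is exponentially $\omega_G$-detectable if and only if 1 and 2 hold. -/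

import Mathlib

open MeasureTheory Filter Topology
open scoped NNReal

noncomputable section

namespace RegionalGradient

/-- The Euclidean space `ℝⁿ`. -/
abbrev E (n : ℕ) : Type := EuclideanSpace ℝ (Fin n)

/-- The state space `L²(Ω)`. -/
abbrev L2 {n : ℕ} (Ω : Set (E n)) : Type := Lp ℝ 2 (volume.restrict Ω)

/-- The space `L²(Ω)ⁿ` of square-integrable vector fields. -/
abbrev L2Vec {n : ℕ} (Ω : Set (E n)) : Type := Lp (E n) 2 (volume.restrict Ω)

/-! ### Domains with smooth boundary and the outward normal -/

/-- `ρ` is a smooth defining function of `Ω` near the boundary point `p`. -/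
def IsDefiningFunction {n : ℕ} (Ω : Set (E n)) (p : E n) (ρ : E n → ℝ) : Prop :=
  ContDiff ℝ (⊤ : ℕ∞) ρ ∧ gradient ρ p ≠ 0 ∧ ∀ᶠ ξ in 𝓝 p, (ξ ∈ Ω ↔ ρ ξ < 0)

/-- A bounded open set with smooth boundary, lying locally on one side of its boundary. -/
structure IsSmoothBoundedDomain {n : ℕ} (Ω : Set (E n)) : Prop where
  isOpen : IsOpen Ω
  isBounded : Bornology.IsBounded Ω
  smooth_boundary : ∀ p ∈ frontier Ω, ∃ ρ : E n → ℝ, IsDefiningFunction Ω p ρ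

open Classical in
/-- The outward unit normal `ν(p)` at a boundary point `p`: the normalized gradient of a defining
function (it does not depend on which one). -/
def outwardNormal {n : ℕ} (Ω : Set (E n)) (p : E n) : E n :=
  if h : ∃ ρ : E n → ℝ, IsDefiningFunction Ω p ρ then
    ‖gradient h.choose p‖⁻¹ • gradient h.choose p
  else 0

/-- Surface measure on the boundary of `Ω`. -/
def surfaceMeasure {n : ℕ} (Ω : Set (E n)) : Measure (E n) :=
  (Measure.euclideanHausdorffMeasure (n - 1)).restrict (frontier Ω)

/-! ### Test functions, weak gradients, Sobolev spaces -/

/-- Smooth functions with compact support contained in `U`. -/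
def IsTest {n : ℕ} (U : Set (E n)) (φ : E n → ℝ) : Prop :=
  ContDiff ℝ (⊤ : ℕ∞) φ ∧ HasCompactSupport φ ∧ tsupport φ ⊆ U

/-- `g` is the weak gradient of `u` on the open set `U`. -/
def HasWeakGradientOn {n : ℕ} (U : Set (E n)) (u : E n → ℝ) (g : E n → E n) : Prop :=
  ∀ φ : E n → ℝ, IsTest U φ →
    ∫ ξ in U, u ξ • gradient φ ξ = -∫ ξ in U, φ ξ • g ξ

/-- Membership of a square-integrable function in `H¹(Ω)`. -/
def MemH1 {n : ℕ} {Ω : Set (E n)} (x : L2 Ω) : Prop :=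
  ∃ g : L2Vec Ω, HasWeakGradientOn Ω x g

lemma IsTest.zero {n : ℕ} (U : Set (E n)) : IsTest U (0 : E n → ℝ) := by
  refine ⟨contDiff_const, HasCompactSupport.zero, ?_⟩
  simp [tsupport]

lemma IsTest.differentiable {n : ℕ} {U : Set (E n)} {φ : E n → ℝ} (h : IsTest U φ) :
    Differentiable ℝ φ := h.1.differentiable (by simp)

lemma IsTest.add {n : ℕ} {U : Set (E n)} {φ χ : E n → ℝ} (h : IsTest U φ) (h' : IsTest U χ) :
    IsTest U (φ + χ) :=
  ⟨h.1.add h'.1, h.2.1.add h'.2.1,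
    (tsupport_add φ χ).trans (Set.union_subset h.2.2 h'.2.2)⟩

lemma IsTest.smul {n : ℕ} {U : Set (E n)} {φ : E n → ℝ} (h : IsTest U φ) (k : ℝ) :
    IsTest U (k • φ) :=
  ⟨contDiff_const.smul h.1, h.2.1.smul_left (f := fun _ => k),
    (closure_mono (Function.support_const_smul_subset k φ)).trans h.2.2⟩

/-- The pairs `(φ, ∇φ)` with `φ` a test function in `Ω`, as a subspace of `L²(Ω) × L²(Ω)ⁿ`. -/
def testGraph {n : ℕ} (Ω : Set (E n)) : Submodule ℝ (L2 Ω × L2Vec Ω) where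
  carrier := {p | ∃ φ : E n → ℝ, IsTest Ω φ ∧
    (p.1 : E n → ℝ) =ᵐ[volume.restrict Ω] φ ∧
    (p.2 : E n → E n) =ᵐ[volume.restrict Ω] gradient φ}
  zero_mem' := by
    refine ⟨0, IsTest.zero Ω, Lp.coeFn_zero _ _ _, ?_⟩
    have h : gradient (0 : E n → ℝ) = 0 := by
      funext ξ
      simp [gradient]
    rw [h]
    exact Lp.coeFn_zero _ _ _
  add_mem' := by
    rintro p p' ⟨φ, hφ, h1, h2⟩ ⟨χ, hχ, h1', h2'⟩
    refine ⟨φ + χ, hφ.add hχ, ?_, ?_⟩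
    · filter_upwards [Lp.coeFn_add p.1 p'.1, h1, h1'] with ξ e e1 e2
      simp only [Prod.fst_add, e, Pi.add_apply, e1, e2]
    · filter_upwards [Lp.coeFn_add p.2 p'.2, h2, h2'] with ξ e e1 e2
      simp only [Prod.snd_add, e, Pi.add_apply, e1, e2]
      simp [gradient, fderiv_add (hφ.differentiable ξ) (hχ.differentiable ξ)]
  smul_mem' := by
    rintro k p ⟨φ, hφ, h1, h2⟩
    refine ⟨k • φ, hφ.smul k, ?_, ?_⟩
    · filter_upwards [Lp.coeFn_smul k p.1, h1] with ξ e e1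
      simp [Prod.smul_fst, e, e1]
    · filter_upwards [Lp.coeFn_smul k p.2, h2] with ξ e e1
      simp only [Prod.smul_snd, e, Pi.smul_apply, e1]
      simp [gradient, fderiv_const_smul (hφ.differentiable ξ)]

/-- `H¹₀(Ω)`, realized as the space of pairs `(u, ∇u)`: the closure of the test functions in the
`H¹` norm. -/
def h10Graph {n : ℕ} (Ω : Set (E n)) : Submodule ℝ (L2 Ω × L2Vec Ω) :=
  (testGraph Ω).topologicalClosure

/-! ### The elliptic operator -/

/-- Coefficients of the symmetric, uniformly elliptic second order operator
`A x = ∑ i j, ∂ⱼ (aᵢⱼ ∂ᵢ x) + c x` on `Ω`, smooth up to the boundary. -/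
structure EllipticCoeffs {n : ℕ} (Ω : Set (E n)) where
  a : Fin n → Fin n → E n → ℝ
  c : E n → ℝ
  smooth_a : ∀ i j, ContDiff ℝ (⊤ : ℕ∞) (a i j)
  smooth_c : ContDiff ℝ (⊤ : ℕ∞) c
  symm : ∀ i j, a i j = a j i
  elliptic : ∃ α : ℝ, 0 < α ∧ ∀ ξ ∈ Ω, ∀ v : E n,
    α * ∑ j, v j ^ 2 ≤ ∑ i, ∑ j, a i j ξ * v i * v j

/-- `z = ∑ i j, ∂ⱼ (aᵢⱼ gᵢ) + c x` in the sense of distributions on `Ω`. -/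
def EllipticCoeffs.WeakEq {n : ℕ} {Ω : Set (E n)} (𝔞 : EllipticCoeffs Ω)
    (x : L2 Ω) (g : L2Vec Ω) (z : L2 Ω) : Prop :=
  ∀ φ : E n → ℝ, IsTest Ω φ →
    ∫ ξ in Ω, (-(∑ i, ∑ j, 𝔞.a i j ξ * g ξ i * gradient φ ξ j) + 𝔞.c ξ * x ξ * φ ξ) =
      ∫ ξ in Ω, z ξ * φ ξ

lemma integrable_mul_test {n : ℕ} {Ω : Set (E n)} (u : E n → ℝ)
    (hu : MemLp u 2 (volume.restrict Ω)) (χ : E n → ℝ) (hχ : Continuous χ)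
    (hs : HasCompactSupport χ) : Integrable (fun ξ => u ξ * χ ξ) (volume.restrict Ω) :=
  hu.integrable_mul ((hχ.memLp_of_hasCompactSupport (p := 2) hs).restrict Ω)

lemma IsTest.continuous_gradient {n : ℕ} {U : Set (E n)} {φ : E n → ℝ} (h : IsTest U φ) :
    Continuous (gradient φ) :=
  (InnerProductSpace.toDual ℝ (E n)).symm.continuous.comp (h.1.continuous_fderiv (by simp))

lemma IsTest.hasCompactSupport_gradient {n : ℕ} {U : Set (E n)} {φ : E n → ℝ}
    (h : IsTest U φ) : HasCompactSupport (gradient φ) :=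
  (h.2.1.fderiv (𝕜 := ℝ)).comp_left (g := (InnerProductSpace.toDual ℝ (E n)).symm) (by simp)

lemma EllipticCoeffs.integrable_lhs {n : ℕ} {Ω : Set (E n)} (𝔞 : EllipticCoeffs Ω)
    (x : L2 Ω) (g : L2Vec Ω) {φ : E n → ℝ} (hφ : IsTest Ω φ) :
    Integrable (fun ξ => -(∑ i, ∑ j, 𝔞.a i j ξ * g ξ i * gradient φ ξ j)
      + 𝔞.c ξ * x ξ * φ ξ) (volume.restrict Ω) := by
  have hg : ∀ i, MemLp (fun ξ => g ξ i) 2 (volume.restrict Ω) := fun i =>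
    (EuclideanSpace.proj (𝕜 := ℝ) i : E n →L[ℝ] ℝ).comp_memLp' (Lp.memLp g)
  refine Integrable.add (Integrable.neg (integrable_finsetSum _ fun i _ =>
    integrable_finsetSum _ fun j _ => ?_)) ?_
  · have h1 : Continuous fun ξ => 𝔞.a i j ξ * gradient φ ξ j :=
      (𝔞.smooth_a i j).continuous.mul
        ((EuclideanSpace.proj (𝕜 := ℝ) j : E n →L[ℝ] ℝ).continuous.comp hφ.continuous_gradient)
    have h2 : HasCompactSupport fun ξ => 𝔞.a i j ξ * gradient φ ξ j :=
      (hφ.hasCompactSupport_gradient.comp_left (g := fun v : E n => v j) (by simp)).mul_left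
    refine (integrable_mul_test _ (hg i) _ h1 h2).congr (ae_of_all _ fun ξ => ?_)
    simp only []
    ring
  · refine (integrable_mul_test _ (Lp.memLp x) (fun ξ => 𝔞.c ξ * φ ξ)
      (𝔞.smooth_c.continuous.mul hφ.1.continuous) hφ.2.1.mul_left).congr
      (ae_of_all _ fun ξ => ?_)
    simp only []
    ring

/-- The graph of the operator `A` with Dirichlet boundary conditions on `L²(Ω)`:
pairs `(x, A x)` with `x ∈ H¹₀(Ω)` and `A x ∈ L²(Ω)`. -/
def EllipticCoeffs.graph {n : ℕ} {Ω : Set (E n)} (𝔞 : EllipticCoeffs Ω) :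
    Submodule ℝ (L2 Ω × L2 Ω) where
  carrier := {p | ∃ g : L2Vec Ω, (p.1, g) ∈ h10Graph Ω ∧ 𝔞.WeakEq p.1 g p.2}
  zero_mem' := by
    refine ⟨0, (h10Graph Ω).zero_mem, fun φ hφ => ?_⟩
    have h1 := Lp.coeFn_zero ℝ 2 (volume.restrict Ω)
    have h2 := Lp.coeFn_zero (E n) 2 (volume.restrict Ω)
    refine integral_congr_ae ?_
    filter_upwards [h1, h2] with ξ e1 e2
    simp only [Prod.fst_zero, Prod.snd_zero, e1, e2]
    simp
  add_mem' := by
    rintro p p' ⟨g, hg, h⟩ ⟨g', hg', h'⟩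
    refine ⟨g + g', (h10Graph Ω).add_mem hg hg', fun φ hφ => ?_⟩
    have e1 := h φ hφ
    have e2 := h' φ hφ
    have i1 := integrable_mul_test _ (Lp.memLp p.2) φ hφ.1.continuous hφ.2.1
    have i2 := integrable_mul_test _ (Lp.memLp p'.2) φ hφ.1.continuous hφ.2.1
    have e3 := congrArg₂ (· + ·) e1 e2
    simp only [] at e3
    rw [← integral_add (𝔞.integrable_lhs _ _ hφ) (𝔞.integrable_lhs _ _ hφ),
      ← integral_add i1 i2] at e3
    refine (integral_congr_ae ?_).trans (e3.trans (integral_congr_ae ?_))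
    · filter_upwards [Lp.coeFn_add p.1 p'.1, Lp.coeFn_add g g'] with ξ a1 a2
      simp only [Prod.fst_add, a1, a2, Pi.add_apply, PiLp.add_apply, mul_add, add_mul,
        Finset.sum_add_distrib]
      ring
    · filter_upwards [Lp.coeFn_add p.2 p'.2] with ξ a1
      simp only [Prod.snd_add, a1, Pi.add_apply]
      ring
  smul_mem' := by
    rintro k p ⟨g, hg, h⟩
    refine ⟨k • g, (h10Graph Ω).smul_mem k hg, fun φ hφ => ?_⟩
    have e3 := congrArg (fun t => k * t) (h φ hφ)
    simp only [] at e3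
    rw [← integral_const_mul, ← integral_const_mul] at e3
    refine (integral_congr_ae ?_).trans (e3.trans (integral_congr_ae ?_))
    · filter_upwards [Lp.coeFn_smul k p.1, Lp.coeFn_smul k g] with ξ a1 a2
      simp only [Prod.smul_fst, a1, a2, Pi.smul_apply, PiLp.smul_apply, smul_eq_mul, mul_add,
        mul_neg, Finset.mul_sum]
      refine congrArg₂ (· + ·) (congrArg Neg.neg ?_) (by ring)
      exact Finset.sum_congr rfl fun i _ => Finset.sum_congr rfl fun j _ => by ring
    · filter_upwards [Lp.coeFn_smul k p.2] with ξ a1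
      simp only [Prod.smul_snd, a1, Pi.smul_apply, smul_eq_mul]
      ring

lemma gradient_coord {n : ℕ} {φ : E n → ℝ} (ξ : E n) (i : Fin n) :
    gradient φ ξ i = fderiv ℝ φ ξ (EuclideanSpace.single i 1) := by
  have h := InnerProductSpace.toDual_symm_apply (𝕜 := ℝ) (E := E n)
    (x := EuclideanSpace.single i 1) (y := fderiv ℝ φ ξ)
  rw [← h, EuclideanSpace.inner_single_right]
  simp [gradient]

lemma weak_of_mem_h10Graph {n : ℕ} {Ω : Set (E n)} {φ : E n → ℝ} (hφ : IsTest Ω φ) (i : Fin n)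
    (P : L2 Ω × L2Vec Ω) (hP : P ∈ h10Graph Ω) :
    ∫ ξ in Ω, (P.1 ξ * gradient φ ξ i + P.2 ξ i * φ ξ) = 0 := by
  have hc1 : Continuous fun ξ => gradient φ ξ i :=
    (EuclideanSpace.proj (𝕜 := ℝ) i : E n →L[ℝ] ℝ).continuous.comp hφ.continuous_gradient
  have hs1 : HasCompactSupport fun ξ => gradient φ ξ i :=
    hφ.hasCompactSupport_gradient.comp_left (g := fun v : E n => v i) (by simp)
  have hc2 : Continuous fun ξ => φ ξ • (EuclideanSpace.single i 1 : E n) :=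
    hφ.1.continuous.smul continuous_const
  have hs2 : HasCompactSupport fun ξ => φ ξ • (EuclideanSpace.single i 1 : E n) :=
    hφ.2.1.smul_right
  have m1 := (hc1.memLp_of_hasCompactSupport (μ := volume) (p := 2) hs1).restrict Ω
  have m2 := (hc2.memLp_of_hasCompactSupport (μ := volume) (p := 2) hs2).restrict Ω
  have key : ∀ P : L2 Ω × L2Vec Ω, ∫ ξ in Ω, (P.1 ξ * gradient φ ξ i + P.2 ξ i * φ ξ) =
      inner ℝ (m1.toLp _) P.1 + inner ℝ (m2.toLp _) P.2 := by
    intro P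
    rw [L2.inner_def, L2.inner_def, ← integral_add (L2.integrable_inner _ _)
      (L2.integrable_inner _ _)]
    refine integral_congr_ae ?_
    filter_upwards [m1.coeFn_toLp, m2.coeFn_toLp] with ξ e1 e2
    rw [e1, e2, inner_smul_left, EuclideanSpace.inner_single_left]
    simp
    ring
  rw [key]
  have hclosed : IsClosed {P : L2 Ω × L2Vec Ω |
      inner ℝ (m1.toLp _) P.1 + inner ℝ (m2.toLp _) P.2 = 0} :=
    isClosed_eq (by fun_prop) continuous_const
  refine closure_minimal (s := (testGraph Ω : Set (L2 Ω × L2Vec Ω))) ?_ hclosed hP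
  rintro Q ⟨χ, hχ, h1, h2⟩
  rw [Set.mem_ofPred_eq, ← key]
  have hd : ∫ ξ in Ω, (Q.1 ξ * gradient φ ξ i + Q.2 ξ i * φ ξ) =
      ∫ ξ in Ω, (χ ξ * gradient φ ξ i + gradient χ ξ i * φ ξ) := by
    refine integral_congr_ae ?_
    filter_upwards [h1, h2] with ξ e1 e2
    rw [e1, e2]
  have hcχ : Continuous fun ξ => gradient χ ξ i :=
    (EuclideanSpace.proj (𝕜 := ℝ) i : E n →L[ℝ] ℝ).continuous.comp hχ.continuous_gradient
  have hsub : ∀ ξ, ξ ∉ Ω → χ ξ * gradient φ ξ i + gradient χ ξ i * φ ξ = 0 := by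
    intro ξ hξ
    have z1 : χ ξ = 0 := by
      by_contra hne
      exact hξ (hχ.2.2 (subset_tsupport _ hne))
    have z2 : φ ξ = 0 := by
      by_contra hne
      exact hξ (hφ.2.2 (subset_tsupport _ hne))
    simp [z1, z2]
  rw [hd, setIntegral_eq_integral_of_forall_compl_eq_zero hsub]
  have j1 : Integrable fun ξ => χ ξ * gradient φ ξ i :=
    (hχ.1.continuous.mul hc1).integrable_of_hasCompactSupport hs1.mul_left
  have j2 : Integrable fun ξ => gradient χ ξ i * φ ξ :=
    (hcχ.mul hφ.1.continuous).integrable_of_hasCompactSupport hφ.2.1.mul_left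
  have j3 : Integrable fun ξ => χ ξ * φ ξ :=
    (hχ.1.continuous.mul hφ.1.continuous).integrable_of_hasCompactSupport hφ.2.1.mul_left
  rw [integral_add j1 j2]
  simp only [gradient_coord] at j1 j2 ⊢
  rw [integral_mul_fderiv_eq_neg_fderiv_mul_of_integrable j2 j1 j3
    (fun ξ _ => hχ.differentiable ξ) (fun ξ _ => hφ.differentiable ξ)]
  ring

/-- The graph is single-valued, so that `A` below is not a junk value. -/
lemma EllipticCoeffs.graph_singleValued {n : ℕ} {Ω : Set (E n)} (hΩ : IsOpen Ω)
    (𝔞 : EllipticCoeffs Ω) (p : L2 Ω × L2 Ω) (hp : p ∈ 𝔞.graph) (h0 : p.1 = 0) : p.2 = 0 := by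
  obtain ⟨g, hg, h⟩ := hp
  have h1 : (p.1 : E n → ℝ) =ᵐ[volume.restrict Ω] 0 := by
    rw [h0]
    exact Lp.coeFn_zero _ _ _
  have loc : ∀ f : E n → ℝ, MemLp f 2 (volume.restrict Ω) →
      (∀ φ, IsTest Ω φ → ∫ ξ in Ω, f ξ * φ ξ = 0) → f =ᵐ[volume.restrict Ω] 0 := by
    intro f hf hz
    have hl : LocallyIntegrableOn f Ω volume :=
      ((locallyIntegrableOn_of_locallyIntegrable_restrict
        (hf.locallyIntegrable (by norm_num))))
    have := hΩ.ae_eq_zero_of_integral_contDiff_smul_eq_zero hl (fun φ c1 c2 c3 => by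
      have e := hz φ ⟨c1, c2, c3⟩
      rw [setIntegral_eq_integral_of_forall_compl_eq_zero] at e
      · rw [← e]
        exact integral_congr_ae (ae_of_all _ fun ξ => by simp [mul_comm])
      · intro ξ hξ
        have : φ ξ = 0 := by
          by_contra hne
          exact hξ (c3 (subset_tsupport _ hne))
        simp [this])
    exact (ae_restrict_iff' hΩ.measurableSet).2 this
  have hgi : ∀ i, (fun ξ => g ξ i) =ᵐ[volume.restrict Ω] 0 := fun i =>
    loc _ ((EuclideanSpace.proj (𝕜 := ℝ) i : E n →L[ℝ] ℝ).comp_memLp' (Lp.memLp g))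
      fun φ hφ => by
        rw [← weak_of_mem_h10Graph hφ i _ hg]
        refine integral_congr_ae ?_
        filter_upwards [h1] with ξ e1
        simp [e1]
  have hz := loc _ (Lp.memLp p.2) fun φ hφ => by
    rw [← h φ hφ]
    refine (integral_congr_ae ?_).trans (integral_zero _ _)
    filter_upwards [h1, ae_all_iff.2 hgi] with ξ e1 e2
    simp only [Pi.zero_apply] at e2
    simp [e1, e2]
  exact (Lp.eq_zero_iff_ae_eq_zero).2 hz

/-- The elliptic operator `A` with Dirichlet boundary conditions, as an unbounded operator on
`L²(Ω)`. -/
def EllipticCoeffs.op {n : ℕ} {Ω : Set (E n)} (𝔞 : EllipticCoeffs Ω) : L2 Ω →ₗ.[ℝ] L2 Ω :=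
  𝔞.graph.toLinearPMap

/-! ### Sensors and the output operator -/

/-- Sensors: a zone sensor `(D, f)`, a pointwise sensor at `b`, a boundary zone sensor `(Γ, f)`. -/
inductive Sensor (n : ℕ) : Type
  | zone (D : Set (E n)) (f : E n → ℝ)
  | pointwise (b : E n)
  | boundaryZone (Γ : Set (E n)) (f : E n → ℝ)

/-- The requirements on support and spatial distribution of a sensor. -/
def Sensor.Admissible {n : ℕ} (Ω : Set (E n)) : Sensor n → Prop
  | .zone D f => D.Nonempty ∧ MeasurableSet D ∧ D ⊆ Ω ∧ MemLp f 2 (volume.restrict D)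
  | .pointwise b => b ∈ closure Ω
  | .boundaryZone Γ f => Γ.Nonempty ∧ MeasurableSet Γ ∧ Γ ⊆ frontier Ω ∧
      MemLp f 2 ((surfaceMeasure Ω).restrict Γ)

/-- `g ∈ L²(∂Ω)` is the normal derivative `∂x/∂ν` of `x ∈ H²(Ω)` in the sense of traces: `x` is the
`H²(Ω)`-limit of smooth functions whose normal derivatives converge to `g` in `L²(∂Ω)`. -/
def HasNormalDerivative {n : ℕ} {Ω : Set (E n)} (x : L2 Ω) (g : E n → ℝ) : Prop :=
  MemLp g 2 (surfaceMeasure Ω) ∧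
  ∃ u : ℕ → E n → ℝ, (∀ k, ContDiff ℝ (⊤ : ℕ∞) (u k)) ∧
    Tendsto (fun k => eLpNorm (fun ξ => u k ξ - x ξ) 2 (volume.restrict Ω)) atTop (𝓝 0) ∧
    (∀ m ∈ ({1, 2} : Set ℕ), Tendsto (fun p : ℕ × ℕ => eLpNorm
      (fun ξ => iteratedFDeriv ℝ m (u p.1) ξ - iteratedFDeriv ℝ m (u p.2) ξ) 2
        (volume.restrict Ω)) atTop (𝓝 0)) ∧
    Tendsto (fun k => eLpNorm (fun η => inner ℝ (gradient (u k) η) (outwardNormal Ω η) - g η) 2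
      (surfaceMeasure Ω)) atTop (𝓝 0)

/-- `y` is the measurement of the state `x` by a sensor: `∫_D x f`, or the value at `b` of the
continuous representative of `x`, or `∫_Γ (∂x/∂ν) f dσ`. -/
def Sensor.Measures {n : ℕ} {Ω : Set (E n)} (x : L2 Ω) (y : ℝ) : Sensor n → Prop
  | .zone D f => y = ∫ ξ in D, x ξ * f ξ
  | .pointwise b => ∃ g : E n → ℝ, ContinuousOn g (closure Ω) ∧
      (x : E n → ℝ) =ᵐ[volume.restrict Ω] g ∧ y = g b
  | .boundaryZone Γ f => ∃ g : E n → ℝ, HasNormalDerivative x g ∧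
      y = ∫ η in Γ, g η * f η ∂(surfaceMeasure Ω)

/-- `C : D(A) → ℝ^q` is the output operator of the sensors `s`: the `i`-th component of `C x` is
the measurement of `x` by `s i`, and `C` is bounded for the graph norm of `A`. -/
def IsOutputOperator {n : ℕ} {Ω : Set (E n)} (A : L2 Ω →ₗ.[ℝ] L2 Ω) {q : ℕ}
    (s : Fin q → Sensor n) (C : A.domain →ₗ[ℝ] (Fin q → ℝ)) : Prop :=
  (∀ (x : A.domain) (i : Fin q), (s i).Measures (x : L2 Ω) (C x i)) ∧
  ∃ K : ℝ, ∀ x : A.domain, ‖C x‖ ≤ K * (‖(x : L2 Ω)‖ + ‖A x‖)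

/-! ### Semigroups and detectability -/

/-- Strongly continuous semigroups of bounded operators. -/
structure IsC0Semigroup {X : Type*} [NormedAddCommGroup X] [NormedSpace ℝ X]
    (S : ℝ≥0 → X →L[ℝ] X) : Prop where
  map_zero : S 0 = ContinuousLinearMap.id ℝ X
  map_add : ∀ t t', S (t + t') = (S t).comp (S t')
  continuous : ∀ x, Continuous fun t => S t x

/-- `B`, with exactly its domain, is the infinitesimal generator of the strongly continuous
semigroup `S`. -/
def Generates {X : Type*} [NormedAddCommGroup X] [NormedSpace ℝ X]
    (B : X →ₗ.[ℝ] X) (S : ℝ≥0 → X →L[ℝ] X) : Prop :=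
  IsC0Semigroup S ∧ ∀ x y : X, (x, y) ∈ B.graph ↔
    Tendsto (fun t : ℝ≥0 => (t : ℝ)⁻¹ • (S t x - x)) (𝓝[>] 0) (𝓝 y)

/-- The operator `A - H C` with domain `D(A)`. -/
def closedLoop {X : Type*} [NormedAddCommGroup X] [NormedSpace ℝ X] (A : X →ₗ.[ℝ] X) {q : ℕ}
    (C : A.domain →ₗ[ℝ] (Fin q → ℝ)) (H : (Fin q → ℝ) →L[ℝ] X) : X →ₗ.[ℝ] X where
  domain := A.domain
  toFun := A.toFun - H.toLinearMap ∘ₗ C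

/-- Asymptotic regional gradient stability on `ω`: for every initial state `x₀ ∈ H¹(Ω)` the
gradient of `S(t) x₀` exists in `L²(ω)ⁿ` and tends to `0` there as `t → ∞`. -/
def IsAsympGradStable {n : ℕ} {Ω : Set (E n)} (ω : Set (E n))
    (S : ℝ≥0 → L2 Ω →L[ℝ] L2 Ω) : Prop :=
  ∀ x₀ : L2 Ω, MemH1 x₀ → ∃ g : ℝ≥0 → L2Vec ω,
    (∀ t, HasWeakGradientOn ω (S t x₀) (g t)) ∧ Tendsto (fun t => ‖g t‖) atTop (𝓝 0)

/-- Exponential regional gradient stability on `ω`: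
`‖∇ S(t) x₀‖_{L²(ω)ⁿ} ≤ M e^{-αt} ‖x₀‖_{H¹}` for all `t ≥ 0` and all `x₀ ∈ H¹₀(Ω)`. -/
def IsExpGradStable {n : ℕ} {Ω : Set (E n)} (ω : Set (E n))
    (S : ℝ≥0 → L2 Ω →L[ℝ] L2 Ω) : Prop :=
  ∃ M α : ℝ, 0 < M ∧ 0 < α ∧ ∀ p ∈ h10Graph Ω, ∃ g : ℝ≥0 → L2Vec ω,
    (∀ t, HasWeakGradientOn ω (S t p.1) (g t)) ∧
    ∀ t : ℝ≥0, ‖g t‖ ≤ M * Real.exp (-α * t) * Real.sqrt (‖p.1‖ ^ 2 + ‖p.2‖ ^ 2)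

/-- Asymptotic regional gradient detectability on `ω` of the system `(A, C)`. -/
def IsAsympGradDetectable {n : ℕ} {Ω : Set (E n)} (ω : Set (E n)) (A : L2 Ω →ₗ.[ℝ] L2 Ω)
    {q : ℕ} (C : A.domain →ₗ[ℝ] (Fin q → ℝ)) : Prop :=
  ∃ (H : (Fin q → ℝ) →L[ℝ] L2 Ω) (S : ℝ≥0 → L2 Ω →L[ℝ] L2 Ω),
    Generates (closedLoop A C H) S ∧ IsAsympGradStable ω S

/-- Exponential regional gradient detectability on `ω` of the system `(A, C)`. -/
def IsExpGradDetectable {n : ℕ} {Ω : Set (E n)} (ω : Set (E n)) (A : L2 Ω →ₗ.[ℝ] L2 Ω)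
    {q : ℕ} (C : A.domain →ₗ[ℝ] (Fin q → ℝ)) : Prop :=
  ∃ (H : (Fin q → ℝ) →L[ℝ] L2 Ω) (S : ℝ≥0 → L2 Ω →L[ℝ] L2 Ω),
    Generates (closedLoop A C H) S ∧ IsExpGradStable ω S

/-! ### Unstable modes and the sensor matrices -/

/-- `lam 0, …, lam (J-1)` are exactly the distinct non-negative eigenvalues of `A`, and
`ψ m 0, …, ψ m (r m - 1)` is a basis of the eigenspace of `lam m`; so `r m` is its multiplicity. -/
structure IsUnstableEigensystem {X : Type*} [NormedAddCommGroup X] [NormedSpace ℝ X]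
    (A : X →ₗ.[ℝ] X) {J : ℕ} (lam : Fin J → ℝ) (r : Fin J → ℕ)
    (ψ : (m : Fin J) → Fin (r m) → A.domain) : Prop where
  injective : Function.Injective lam
  mem_iff : ∀ μ : ℝ, (0 ≤ μ ∧ ∃ x : A.domain, x ≠ 0 ∧ A x = μ • (x : X)) ↔ ∃ m, lam m = μ
  eigen : ∀ m j, A (ψ m j) = lam m • (ψ m j : X)
  linearIndependent : ∀ m, LinearIndependent ℝ (ψ m)
  span : ∀ m (x : A.domain), A x = lam m • (x : X) → x ∈ Submodule.span ℝ (Set.range (ψ m))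

/-- The gradients of `ψ₁, …, ψ_k`, restricted to `ω`, are linearly independent. -/
def GradLinearIndependentOn {n : ℕ} {Ω : Set (E n)} (ω : Set (E n)) {k : ℕ}
    (ψ : Fin k → L2 Ω) : Prop :=
  ∀ v : Fin k → ℝ, HasWeakGradientOn ω (∑ j, v j • ψ j : L2 Ω) (fun _ => 0) → v = 0

/-- The matrix `(G_m)_{ij}` of the responses of the `i`-th sensor to the `j`-th eigenfunction. -/
def sensorMatrix {X : Type*} [NormedAddCommGroup X] [NormedSpace ℝ X] {A : X →ₗ.[ℝ] X} {q k : ℕ}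
    (C : A.domain →ₗ[ℝ] (Fin q → ℝ)) (ψ : Fin k → A.domain) : Matrix (Fin q) (Fin k) ℝ :=
  Matrix.of fun i j => C (ψ j) i

end RegionalGradient

end

open MeasureTheory Filter Topology
open scoped NNReal

noncomputable section

namespace RegionalGradient

open scoped InnerProductSpace

/-! ### Diagonal operators in a Hilbert basis -/

section Diagonal

variable {K X : Type*} [NormedAddCommGroup X] [InnerProductSpace ℝ X]

/-! Necessity. If `G_m v = 0`, then `x = ∑ v_j ψ_mj` is an eigenvector of `A` or zero, and `C x =
0`. No feedback acts on it: `(A - HC) x = λ_m x` for every `H`, hence `S_H(t) x = e^{λ_m t} x` by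
`Generates.apply_eigenvector`. As `λ_m ≥ 0`, the gradient can tend to zero on `ω` only if it
vanishes there (`hasWeakGradientOn_zero_of_tendsto`), and independence of the gradients gives `v =
0`. So `G_m` is injective, which means `rank G_m = r_m`, and `r ≤ q` follows by counting rows.

Sufficiency. The rank conditions say that no non-zero eigenvector for a non-negative eigenvalue lies
in `ker C` (the Hautus test). The form of `c₀ - A` is coercive on `H¹₀(Ω)`, which embeds compactly
into `L²(Ω)`, so `A` is diagonal in a Hilbert basis with eigenvalues tending to `-∞`
(`exists_isDiagonal_of_form`); only a finite set `U` of modes is unstable.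

The feedback (`IsDiagonal.exists_feedback`) is explicit. With `y_i = C b_i` and `L_i = C (A + λ_i +
2δ)⁻¹`, the functionals `w_i = y_i · L_i`, `i ∈ U`, satisfy `w_i(A x) + (λ_i + 2δ) w_i(x) = y_i · C
x`. If `H` is chosen with `w_i(H u) = y_i · u`, then `w_i((A - HC) x) = -(λ_i + 2δ) w_i(x)`: each
`w_i` is a left eigenvector of the closed loop with negative eigenvalue. Such an `H` exists because
the matrix `W_ij = w_i(b_j) = y_i · y_j / (λ_i + λ_j + 2δ)` is invertible; it solves a Lyapunov
equation, and the Hautus test excludes a kernel. Replacing the coordinates in `U` by the `w_i`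
conjugates `A - HC` to a diagonal operator with spectrum below `-γ < 0`.

The decay is then measured in the energy norm of `H¹₀(Ω)`, which controls the gradient on `ω`:
`IsDiagonal.energy_decay` treats initial data in `H¹₀`, and `IsDiagonal.energy_smoothing` treats
arbitrary data in `L²`, among them those in `H¹` with non-zero trace. -/

lemma hilbertBasis_ext (b : HilbertBasis K ℝ X) {x y : X} (h : ∀ k, ⟪b k, x⟫_ℝ = ⟪b k, y⟫_ℝ) :
    x = y := by
  apply b.repr.injective
  ext k
  simpa [b.repr_apply_apply] using h k

lemma memℓp_mul_of_abs_le {d : K → ℝ} {M : ℝ} (hd : ∀ k, |d k| ≤ M)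
    (f : lp (fun _ : K => ℝ) 2) : Memℓp (fun k => d k * f k) 2 := by
  have hf := (memℓp_gen_iff (by norm_num)).1 (lp.memℓp f)
  refine (memℓp_gen_iff (by norm_num)).2 ?_
  refine Summable.of_nonneg_of_le (fun k => by positivity) (fun k => ?_) (hf.mul_left (M ^ 2))
  have hM : |d k| ^ 2 ≤ M ^ 2 := pow_le_pow_left₀ (abs_nonneg _) (hd k) 2
  simp only [ENNReal.toReal_ofNat, Real.rpow_ofNat, norm_mul, mul_pow]
  exact mul_le_mul_of_nonneg_right hM (by positivity)

lemma norm_sq_eq_tsum (b : HilbertBasis K ℝ X) (x : X) : ‖x‖ ^ 2 = ∑' k, ⟪b k, x⟫_ℝ ^ 2 := by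
  rw [← real_inner_self_eq_norm_sq, ← b.tsum_inner_mul_inner x x]
  exact tsum_congr fun k => by rw [real_inner_comm, sq]

lemma summable_inner_sq (b : HilbertBasis K ℝ X) (x : X) :
    Summable fun k => ⟪b k, x⟫_ℝ ^ 2 :=
  (b.summable_inner_mul_inner x x).congr fun k => by rw [real_inner_comm, sq]

/-- The linear map which multiplies the `k`-th coordinate by `d k`, for bounded `d`. -/
def diagLinear (b : HilbertBasis K ℝ X) (d : K → ℝ) (hd : ∃ M, ∀ k, |d k| ≤ M) : X →ₗ[ℝ] X where
  toFun x := b.repr.symm ⟨fun k => d k * b.repr x k, memℓp_mul_of_abs_le hd.choose_spec _⟩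
  map_add' x y := by
    rw [← map_add]
    congr 1
    ext k
    simp only [map_add, lp.coeFn_add, Pi.add_apply]
    exact mul_add _ _ _
  map_smul' c x := by
    rw [RingHom.id_apply, ← map_smul]
    congr 1
    ext k
    simp
    ring

lemma inner_diagLinear (b : HilbertBasis K ℝ X) (d : K → ℝ) (hd : ∃ M, ∀ k, |d k| ≤ M) (x : X)
    (k : K) : ⟪b k, diagLinear b d hd x⟫_ℝ = d k * ⟪b k, x⟫_ℝ := by
  rw [← b.repr_apply_apply, ← b.repr_apply_apply]
  simp [diagLinear]

lemma norm_le_mul_of_abs_inner_le (b : HilbertBasis K ℝ X) {x y : X} {M : ℝ} (hM : 0 ≤ M)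
    (h : ∀ k, |⟪b k, y⟫_ℝ| ≤ M * |⟪b k, x⟫_ℝ|) : ‖y‖ ≤ M * ‖x‖ := by
  refine le_of_sq_le_sq ?_ (by positivity)
  rw [mul_pow, norm_sq_eq_tsum b, norm_sq_eq_tsum b, ← tsum_mul_left]
  refine (summable_inner_sq b y).tsum_le_tsum (fun k => ?_) ((summable_inner_sq b x).mul_left _)
  rw [← sq_abs, ← sq_abs ⟪b k, x⟫_ℝ, ← mul_pow]
  exact pow_le_pow_left₀ (abs_nonneg _) (h k) 2

open Classical in
/-- The diagonal operator with bounded diagonal `d` in the Hilbert basis `b`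
(and `0` if `d` is unbounded). -/
def diag (b : HilbertBasis K ℝ X) (d : K → ℝ) : X →L[ℝ] X :=
  if hd : ∃ M, ∀ k, |d k| ≤ M then
    (diagLinear b d hd).mkContinuous (|hd.choose|) fun x =>
      norm_le_mul_of_abs_inner_le b (abs_nonneg _) fun k => by
        rw [inner_diagLinear, abs_mul]
        exact mul_le_mul_of_nonneg_right ((hd.choose_spec k).trans (le_abs_self _)) (abs_nonneg _)
  else 0

variable {b : HilbertBasis K ℝ X}

lemma inner_diag {d : K → ℝ} (hd : ∃ M, ∀ k, |d k| ≤ M) (x : X) (k : K) :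
    ⟪b k, diag b d x⟫_ℝ = d k * ⟪b k, x⟫_ℝ := by
  simp only [diag, hd, dite_true, LinearMap.mkContinuous_apply]
  exact inner_diagLinear b d hd x k

lemma norm_diag_apply_le {d : K → ℝ} {M : ℝ} (hM : 0 ≤ M) (hd : ∀ k, |d k| ≤ M) (x : X) :
    ‖diag b d x‖ ≤ M * ‖x‖ :=
  norm_le_mul_of_abs_inner_le b hM fun k => by
    rw [inner_diag ⟨M, hd⟩, abs_mul]
    exact mul_le_mul_of_nonneg_right (hd k) (abs_nonneg _)

open Classical in
lemma inner_basis (b : HilbertBasis K ℝ X) (k j : K) : ⟪b k, b j⟫_ℝ = if k = j then 1 else 0 :=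
  orthonormal_iff_ite.1 b.orthonormal k j

lemma inner_diag_eq_tsum {d : K → ℝ} (hd : ∃ M, ∀ k, |d k| ≤ M) (x y : X) :
    HasSum (fun k => d k * ⟪b k, x⟫_ℝ * ⟪b k, y⟫_ℝ) ⟪diag b d x, y⟫_ℝ := by
  refine (b.hasSum_inner_mul_inner (diag b d x) y).congr_fun fun k => ?_
  rw [real_inner_comm _ (diag b d x), inner_diag hd]

/-- By Parseval the squared distance is a series in the coordinates, so dominated convergence for
series applies. Strong continuity of the diagonal semigroup and the difference quotient of its
generator both come from this. -/
lemma tendsto_diag {T : Type*} {l : Filter T} [l.IsCountablyGenerated] {d : T → K → ℝ}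
    {d₀ : K → ℝ} {M : ℝ} (hd : ∀ᶠ t in l, ∀ k, |d t k| ≤ M) (hd₀ : ∀ k, |d₀ k| ≤ M)
    (h : ∀ k, Tendsto (fun t => d t k) l (𝓝 (d₀ k))) (x : X) :
    Tendsto (fun t => diag b (d t) x) l (𝓝 (diag b d₀ x)) := by
  rw [tendsto_iff_norm_sub_tendsto_zero]
  have key : Tendsto (fun t => ∑' k, ((d t k - d₀ k) * ⟪b k, x⟫_ℝ) ^ 2) l
      (𝓝 (∑' k, ((d₀ k - d₀ k) * ⟪b k, x⟫_ℝ) ^ 2)) := by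
    refine tendsto_tsum_of_dominated_convergence ((summable_inner_sq b x).mul_left ((2 * M) ^ 2))
      (fun k => (((h k).sub_const _).mul_const _).pow 2) ?_
    filter_upwards [hd] with t ht k
    rw [Real.norm_eq_abs, abs_of_nonneg (sq_nonneg _), mul_pow]
    refine mul_le_mul_of_nonneg_right ?_ (sq_nonneg _)
    rw [← sq_abs]
    refine pow_le_pow_left₀ (abs_nonneg _) ?_ 2
    calc |d t k - d₀ k| ≤ |d t k| + |d₀ k| := abs_sub _ _
      _ ≤ 2 * M := by linarith [ht k, hd₀ k]
  simp only [sub_self, zero_mul, ne_eq, OfNat.ofNat_ne_zero, not_false_eq_true, zero_pow,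
    tsum_zero] at key
  have key2 := key.sqrt
  rw [Real.sqrt_zero] at key2
  refine key2.congr' ?_
  filter_upwards [hd] with t ht
  rw [← Real.sqrt_sq (norm_nonneg (diag b (d t) x - diag b d₀ x)), norm_sq_eq_tsum b]
  congr 1
  refine tsum_congr fun k => ?_
  rw [inner_sub_right, inner_diag ⟨M, ht⟩, inner_diag ⟨M, hd₀⟩, sub_mul]

lemma eq_sum_of_inner_eq_zero (b : HilbertBasis K ℝ X) {U : Finset K} {x : X}
    (h : ∀ k ∉ U, ⟪b k, x⟫_ℝ = 0) : x = ∑ i ∈ U, ⟪b i, x⟫_ℝ • b i := by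
  classical
  refine hilbertBasis_ext b fun k => ?_
  simp only [inner_sum, inner_smul_right, inner_basis]
  by_cases hk : k ∈ U
  · simp [hk]
  · simp [hk, h k hk]

end Diagonal

/-! ### Compact self-adjoint operators -/

section Spectral

universe u

variable {X : Type u} [NormedAddCommGroup X] [InnerProductSpace ℝ X]

/-- A compact self-adjoint operator has a Hilbert basis of eigenvectors. -/
theorem exists_hilbertBasis_eigenvectors [CompleteSpace X] (R : X →L[ℝ] X) (hR : IsCompactOperator R)
    (hs : R.IsSymmetric) :
    ∃ (K : Type u) (b : HilbertBasis K ℝ X) (ρ : K → ℝ), ∀ k, R (b k) = ρ k • b k := by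
  have hclosed : ∀ μ : ℝ, IsClosed
      (Module.End.eigenspace (R : Module.End ℝ X) μ : Set X) := by
    intro μ
    have : (Module.End.eigenspace (R : Module.End ℝ X) μ : Set X) = {x | R x = μ • x} := by
      ext x
      exact Module.End.mem_eigenspace_iff
    rw [this]
    exact isClosed_eq R.continuous (continuous_const_smul μ)
  have hcomplete : ∀ μ : ℝ, CompleteSpace (Module.End.eigenspace (R : Module.End ℝ X) μ) :=
    fun μ => (hclosed μ).completeSpace_coe
  -- The index `μ` runs over all reals; a `μ` that is not an eigenvalue has trivial eigenspace and
  -- contributes no vector.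
  choose w v hv using fun μ : ℝ =>
    exists_hilbertBasis ℝ (Module.End.eigenspace (R : Module.End ℝ X) μ)
  have hfam := hs.orthogonalFamily_eigenspaces
  have hon := hfam.orthonormal_sigma_orthonormal (v_family := fun μ => ⇑(v μ))
    fun μ => (v μ).orthonormal
  refine ⟨Σ μ : ℝ, w μ, HilbertBasis.mkOfOrthogonalEqBot hon ?_, fun k => k.1, fun k => ?_⟩
  · rw [eq_bot_iff, ← ContinuousLinearMap.orthogonalComplement_iSup_eigenspaces_eq_bot hR hs]
    intro x hx
    rw [← Submodule.iInf_orthogonal, Submodule.mem_iInf]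
    intro μ
    rw [Submodule.mem_orthogonal]
    intro y hy
    have h0 : ∀ z ∈ Submodule.span ℝ (Set.range (v μ)), ⟪(z : X), x⟫_ℝ = 0 := by
      intro z hz
      refine Submodule.span_induction ?_ (by simp) (fun a c _ _ ha hc => ?_)
        (fun r a _ ha => ?_) hz
      · rintro _ ⟨i, rfl⟩
        exact (Submodule.mem_orthogonal _ _).1 hx _ (Submodule.subset_span ⟨⟨μ, i⟩, rfl⟩)
      · rw [Submodule.coe_add, inner_add_left, ha, hc, add_zero]
      · rw [Submodule.coe_smul, inner_smul_left, ha, mul_zero]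
    have h1 : IsClosed {z : Module.End.eigenspace (R : Module.End ℝ X) μ | ⟪(z : X), x⟫_ℝ = 0} :=
      isClosed_eq (by fun_prop) continuous_const
    have h2 : (⟨y, hy⟩ : Module.End.eigenspace (R : Module.End ℝ X) μ) ∈
        (Submodule.span ℝ (Set.range (v μ))).topologicalClosure := by
      rw [(v μ).dense_span]
      trivial
    have h3 : ((Submodule.span ℝ (Set.range (v μ)) : Submodule ℝ _) : Set _) ⊆
        {z : Module.End.eigenspace (R : Module.End ℝ X) μ | ⟪(z : X), x⟫_ℝ = 0} :=
      fun z hz => h0 z hz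
    exact closure_minimal h3 h1 h2
  · rw [HilbertBasis.coe_mkOfOrthogonalEqBot]
    exact Module.End.mem_eigenspace_iff.1 (v k.1 k.2).2

/-- The eigenvalues of a compact operator accumulate only at `0`. -/
theorem finite_eigenvalues_ge {K : Type*} (R : X →L[ℝ] X) (hR : IsCompactOperator R)
    (b : HilbertBasis K ℝ X) {ρ : K → ℝ} (hρ : ∀ k, R (b k) = ρ k • b k) {ε : ℝ} (hε : 0 < ε) :
    {k | ε ≤ ρ k}.Finite := by
  classical
  have htb : TotallyBounded (R '' Metric.closedBall 0 1) :=
    (hR.isCompact_closure_image_closedBall (𝕜₁ := ℝ) (f := (R : X →ₗ[ℝ] X)) 1).totallyBounded.subset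
      subset_closure
  obtain ⟨t, ht, hcov⟩ := Metric.totallyBounded_iff.1 htb (ε / 2) (half_pos hε)
  -- With infinitely many such `k`, two images `R (b i)`, `R (b j)` fall into one ball of radius `ε
  -- / 2`; but pairing `ρ i • b i - ρ j • b j` with `b i` shows that they are at least `ρ i ≥ ε`
  -- apart.
  by_contra hinf
  have hb : ∀ k, ∃ y ∈ t, dist (R (b k)) y < ε / 2 := by
    intro k
    have : R (b k) ∈ R '' Metric.closedBall 0 1 :=
      ⟨b k, by simp [b.orthonormal.1 k], rfl⟩
    simpa using hcov this
  choose f hft hf using hb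
  obtain ⟨i, hi, j, hj, hij, hfij⟩ :=
    Set.Infinite.exists_ne_map_eq_of_mapsTo (f := f) hinf (fun k _ => hft k) ht
  have hd : dist (R (b i)) (R (b j)) < ε := by
    calc _ ≤ dist (R (b i)) (f i) + dist (R (b j)) (f i) := dist_triangle_right _ _ _
      _ < ε / 2 + ε / 2 := add_lt_add (hf i) (hfij ▸ hf j)
      _ = ε := by ring
  rw [dist_eq_norm, hρ, hρ] at hd
  have h1 : ⟪b i, ρ i • b i - ρ j • b j⟫_ℝ = ρ i := by
    simp [inner_sub_right, inner_smul_right, inner_basis, hij, b.orthonormal.1 i]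
  have h2 := abs_real_inner_le_norm (b i) (ρ i • b i - ρ j • b j)
  rw [h1, b.orthonormal.1 i, one_mul] at h2
  exact absurd (hi.trans ((le_abs_self _).trans h2)) (not_le.2 hd)

end Spectral

/-! ### The semigroup generated by a diagonal operator -/

section DiagonalSemigroup

variable {K X : Type*} [NormedAddCommGroup X] [InnerProductSpace ℝ X]
  {b : HilbertBasis K ℝ X} {σ : K → ℝ}

lemma abs_exp_mul_le_one (hσ : ∀ k, σ k ≤ 0) {t : ℝ} (ht : 0 ≤ t) (k : K) :
    |Real.exp (t * σ k)| ≤ 1 := by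
  rw [abs_of_pos (Real.exp_pos _)]
  exact Real.exp_le_one_iff.2 (mul_nonpos_of_nonneg_of_nonpos ht (hσ k))

/-- The dominating bound for the difference quotients, from `1 + s ≤ e^s ≤ 1` for `s ≤ 0`. For `σ k
= 0` the quotient is `0 / 0 = 0`. -/
lemma abs_exp_sub_one_div_le_one (hσ : ∀ k, σ k ≤ 0) {t : ℝ} (ht : 0 < t) (k : K) :
    |(Real.exp (t * σ k) - 1) / (t * σ k)| ≤ 1 := by
  rcases (hσ k).lt_or_eq with h | h
  · have h1 : t * σ k < 0 := mul_neg_of_pos_of_neg ht h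
    have h2 := Real.add_one_le_exp (t * σ k)
    have h3 : Real.exp (t * σ k) ≤ 1 := Real.exp_le_one_iff.2 h1.le
    rw [abs_div, abs_of_neg h1, abs_of_nonpos (by linarith), div_le_one (by linarith)]
    linarith
  · simp [h]

/-- If `y_k = σ_k x_k`, the difference quotient of `x` is the diagonal operator with entries
`(e^{tσ_k} - 1) / (tσ_k)` applied to `y`; these are bounded by `1` and tend to `1`. Conversely, a
limit can be read off coordinate by coordinate. -/
lemma diag_exp_generator (hσ : ∀ k, σ k < 0) (x y : X) :
    (∀ k, ⟪b k, y⟫_ℝ = σ k * ⟪b k, x⟫_ℝ) ↔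
      Tendsto (fun t : ℝ≥0 => (t : ℝ)⁻¹ • (diag b (fun k => Real.exp (t * σ k)) x - x)) (𝓝[>] 0)
        (𝓝 y) := by
  have hσ' : ∀ k, σ k ≤ 0 := fun k => (hσ k).le
  have hcoe : Tendsto (fun t : ℝ≥0 => (t : ℝ)) (𝓝[>] 0) (𝓝[>] 0) := by
    refine tendsto_nhdsWithin_iff.2 ⟨?_, ?_⟩
    · exact (NNReal.continuous_coe.tendsto' 0 0 NNReal.coe_zero).mono_left nhdsWithin_le_nhds
    · filter_upwards [self_mem_nhdsWithin] with t ht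
      exact NNReal.coe_pos.2 ht
  have hslope : ∀ k, Tendsto (fun t : ℝ => t⁻¹ * (Real.exp (t * σ k) - 1)) (𝓝[>] 0)
      (𝓝 (σ k)) := by
    intro k
    have h : HasDerivAt (fun t : ℝ => Real.exp (t * σ k)) (σ k) 0 := by
      simpa using ((hasDerivAt_id (0 : ℝ)).mul_const (σ k)).exp
    have h2 := (hasDerivAt_iff_tendsto_slope_zero.1 h).mono_left
      (nhdsWithin_mono 0 (fun t (ht : 0 < t) => ht.ne') : 𝓝[>] (0 : ℝ) ≤ 𝓝[≠] 0)
    simpa using h2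
  have hbd : ∀ t : ℝ≥0, ∃ M, ∀ k, |Real.exp (t * σ k)| ≤ M := fun t =>
    ⟨1, abs_exp_mul_le_one hσ' t.2⟩
  constructor
  · intro h
    have key : Tendsto (fun t : ℝ≥0 =>
        diag b (fun k => (Real.exp (t * σ k) - 1) / (t * σ k)) y) (𝓝[>] 0)
        (𝓝 (diag b (fun _ => 1) y)) := by
      refine tendsto_diag (M := 1) ?_ (by simp) (fun k => ?_) y
      · filter_upwards [self_mem_nhdsWithin] with t ht k
        exact abs_exp_sub_one_div_le_one hσ' (NNReal.coe_pos.2 ht) k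
      · have := ((hslope k).comp hcoe).mul_const (σ k)⁻¹
        rw [mul_inv_cancel₀ (hσ k).ne] at this
        refine this.congr fun t => ?_
        simp only [Function.comp_apply, div_eq_mul_inv, mul_inv]
        ring
    have e1 : diag b (fun _ => 1) y = y :=
      hilbertBasis_ext b fun k => by rw [inner_diag ⟨1, by simp⟩, one_mul]
    rw [e1] at key
    refine key.congr' ?_
    filter_upwards [self_mem_nhdsWithin] with t ht
    have ht' : (t : ℝ) ≠ 0 := (NNReal.coe_pos.2 ht).ne'
    refine hilbertBasis_ext b fun k => ?_
    rw [inner_diag ⟨1, abs_exp_sub_one_div_le_one hσ' (NNReal.coe_pos.2 ht)⟩, inner_smul_right,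
      inner_sub_right, inner_diag (hbd t), h k]
    have := (hσ k).ne
    field_simp
  · intro h k
    have h1 := (h.inner (tendsto_const_nhds (x := b k))).congr fun t => real_inner_comm _ _
    have h2 := ((hslope k).comp hcoe).mul_const ⟪b k, x⟫_ℝ
    rw [real_inner_comm]
    refine tendsto_nhds_unique h1 (h2.congr fun t => ?_)
    rw [inner_smul_right, inner_sub_right, inner_diag (hbd t)]
    simp only [Function.comp_apply]
    ring

lemma continuous_diag_exp (hσ : ∀ k, σ k ≤ 0) (x : X) :
    Continuous fun t : ℝ≥0 => diag b (fun k => Real.exp (t * σ k)) x := by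
  refine continuous_iff_continuousAt.2 fun t₀ => ?_
  refine tendsto_diag (M := 1) (Eventually.of_forall fun t => abs_exp_mul_le_one hσ t.2)
    (abs_exp_mul_le_one hσ t₀.2) (fun k => ?_) x
  exact (by fun_prop : Continuous fun t : ℝ≥0 => Real.exp (t * σ k)).tendsto t₀

/-- An operator which is conjugate to a negative diagonal operator generates the conjugate
semigroup. -/
lemma generates_conj (hσ : ∀ k, σ k < 0) (Θ : X ≃L[ℝ] X) {B : X →ₗ.[ℝ] X}
    (hB : ∀ x y, (x, y) ∈ B.graph ↔ ∀ k, ⟪b k, Θ y⟫_ℝ = σ k * ⟪b k, Θ x⟫_ℝ) :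
    Generates B fun t : ℝ≥0 =>
      (Θ.symm : X →L[ℝ] X).comp ((diag b fun k => Real.exp (t * σ k)).comp (Θ : X →L[ℝ] X)) := by
  have hσ' : ∀ k, σ k ≤ 0 := fun k => (hσ k).le
  have hbd : ∀ t : ℝ≥0, ∃ M, ∀ k, |Real.exp (t * σ k)| ≤ M := fun t =>
    ⟨1, abs_exp_mul_le_one hσ' t.2⟩
  refine ⟨⟨?_, fun t t' => ?_, fun x => ?_⟩, fun x y => ?_⟩
  · ext x
    have : diag b (fun k => Real.exp ((0 : ℝ≥0) * σ k)) (Θ x) = Θ x :=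
      hilbertBasis_ext b fun k => by rw [inner_diag (hbd 0)]; simp
    simp only [ContinuousLinearMap.comp_apply, ContinuousLinearEquiv.coe_coe, this,
      ContinuousLinearEquiv.symm_apply_apply, ContinuousLinearMap.id_apply]
  · ext x
    simp only [ContinuousLinearMap.comp_apply, ContinuousLinearEquiv.coe_coe,
      ContinuousLinearEquiv.apply_symm_apply]
    congr 1
    refine hilbertBasis_ext b fun k => ?_
    rw [inner_diag (hbd _), inner_diag (hbd _), inner_diag (hbd _), NNReal.coe_add, add_mul,
      Real.exp_add, mul_assoc]
  · exact Θ.symm.continuous.comp (continuous_diag_exp hσ' (Θ x))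
  · rw [hB, diag_exp_generator hσ]
    have e : ∀ t : ℝ≥0, Θ ((t : ℝ)⁻¹ • ((Θ.symm (diag b (fun k => Real.exp (t * σ k)) (Θ x))) - x))
        = (t : ℝ)⁻¹ • (diag b (fun k => Real.exp (t * σ k)) (Θ x) - Θ x) := by
      intro t
      rw [map_smul, map_sub, ContinuousLinearEquiv.apply_symm_apply]
    constructor
    · intro h
      have h1 := (Θ.symm.continuous.tendsto _).comp h
      rw [ContinuousLinearEquiv.symm_apply_apply] at h1
      refine h1.congr fun t => ?_
      simp only [Function.comp_apply]
      rw [← e, ContinuousLinearEquiv.symm_apply_apply]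
      rfl
    · intro h
      exact ((Θ.continuous.tendsto _).comp h).congr e

end DiagonalSemigroup

/-! ### A criterion for invertibility of Gram type matrices -/

section Gram

open scoped Matrix

variable {U : Type*} [Fintype U] {q : ℕ} {l : U → ℝ} {y : U → Fin q → ℝ}

/-- The matrix with entries `⟪yᵢ, yⱼ⟫ / (lᵢ + lⱼ + 2 δ)`. -/
def gramMatrix (l : U → ℝ) (y : U → Fin q → ℝ) (δ : ℝ) : Matrix U U ℝ :=
  Matrix.of fun i j => (∑ p, y i p * y j p) / (l j + (l i + 2 * δ))

variable {δ : ℝ}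

/-- Lyapunov identity: with `D = diag(l + δ)` and `Y` the matrix with rows `y_i`, the Gram type
matrix `W` satisfies `D W + W D = Y Yᵀ`. If `W v = 0`, symmetry of `W` makes both terms vanish when
paired with `v` on both sides, so `|Yᵀ v|² = 0`. -/
lemma sum_smul_eq_zero_of_gramMatrix (hl : ∀ i, 0 ≤ l i) (hδ : 0 < δ) {v : U → ℝ}
    (hv : gramMatrix l y δ *ᵥ v = 0) : ∑ j, v j • y j = 0 := by
  have hsum : ∀ i, ∑ j, (∑ p, y i p * y j p) / (l j + (l i + 2 * δ)) * v j = 0 := fun i =>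
    congrFun hv i
  have h1 : ∑ i, ∑ j, v i * (l i + δ) * ((∑ p, y i p * y j p) / (l j + (l i + 2 * δ)) * v j) = 0 :=
    Finset.sum_eq_zero fun i _ => by rw [← Finset.mul_sum, hsum, mul_zero]
  have h2 : ∑ i, ∑ j, v j * (l j + δ) * ((∑ p, y i p * y j p) / (l j + (l i + 2 * δ)) * v i) = 0 := by
    rw [Finset.sum_comm, ← h1]
    refine Finset.sum_congr rfl fun i _ => Finset.sum_congr rfl fun j _ => ?_
    rw [show l i + (l j + 2 * δ) = l j + (l i + 2 * δ) by ring]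
    simp only [mul_comm (y j _)]
  have h3 : ∑ p, (∑ j, v j • y j) p ^ 2 = 0 := by
    have : ∑ p, (∑ j, v j • y j) p ^ 2 = ∑ i, ∑ j, v i * v j * ∑ p, y i p * y j p := by
      simp only [Finset.sum_apply, Pi.smul_apply, smul_eq_mul, sq, Finset.sum_mul_sum]
      rw [Finset.sum_comm]
      refine Finset.sum_congr rfl fun i _ => ?_
      rw [Finset.sum_comm]
      refine Finset.sum_congr rfl fun j _ => ?_
      rw [Finset.mul_sum]
      exact Finset.sum_congr rfl fun p _ => by ring
    rw [this, ← add_zero (0 : ℝ), ← congrArg₂ (· + ·) h1 h2, ← Finset.sum_add_distrib]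
    refine Finset.sum_congr rfl fun i _ => ?_
    rw [← Finset.sum_add_distrib]
    refine Finset.sum_congr rfl fun j _ => ?_
    have : l j + (l i + 2 * δ) ≠ 0 := by linarith [hl i, hl j]
    generalize ∑ p, y i p * y j p = c
    have hc : c = c / (l j + (l i + 2 * δ)) * (l j + (l i + 2 * δ)) :=
      (div_mul_cancel₀ _ this).symm
    generalize c / (l j + (l i + 2 * δ)) = d at hc ⊢
    rw [hc]
    ring
  funext p
  have := (Finset.sum_eq_zero_iff_of_nonneg fun p _ => sq_nonneg _).1 h3 p (Finset.mem_univ p)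
  simpa using this

/-- The kernel of `W` is invariant under `diag(l)`: in row `i` write `l_j - μ = (l_j + l_i + 2δ) -
(l_i + 2δ + μ)`. The first part cancels the denominator and leaves `y_i · ∑ v_j y_j = 0`; the second
is a multiple of `(W v)_i`. -/
lemma gramMatrix_mulVec_mul_sub (hl : ∀ i, 0 ≤ l i) (hδ : 0 < δ) {v : U → ℝ}
    (hv : gramMatrix l y δ *ᵥ v = 0) (μ : ℝ) :
    gramMatrix l y δ *ᵥ (fun j => (l j - μ) * v j) = 0 := by
  have h0 := sum_smul_eq_zero_of_gramMatrix hl hδ hv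
  funext i
  have hi : ∑ j, (∑ p, y i p * y j p) / (l j + (l i + 2 * δ)) * v j = 0 := congrFun hv i
  change ∑ j, (∑ p, y i p * y j p) / (l j + (l i + 2 * δ)) * ((l j - μ) * v j) = 0
  have h1 : ∑ j, (∑ p, y i p * y j p) * v j = 0 := by
    simp only [Finset.sum_mul]
    rw [Finset.sum_comm]
    refine Finset.sum_eq_zero fun p _ => ?_
    have := congrFun h0 p
    simp only [Finset.sum_apply, Pi.smul_apply, smul_eq_mul, Pi.zero_apply] at this
    rw [← mul_zero (y i p), ← this, Finset.mul_sum]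
    exact Finset.sum_congr rfl fun j _ => by ring
  have h2 : ∑ j, (l i + 2 * δ + μ) *
      ((∑ p, y i p * y j p) / (l j + (l i + 2 * δ)) * v j) = 0 := by
    rw [← Finset.mul_sum, hi, mul_zero]
  rw [← sub_zero (0 : ℝ), ← congrArg₂ (· - ·) h1 h2, ← Finset.sum_sub_distrib]
  refine Finset.sum_congr rfl fun j _ => ?_
  have : l j + (l i + 2 * δ) ≠ 0 := by linarith [hl i, hl j]
  generalize ∑ p, y i p * y j p = c
  field_simp
  ring

/-- If no nonzero combination of the `yⱼ` with equal `lⱼ` vanishes, the matrix is injective. -/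
lemma gramMatrix_mulVec_injective (hl : ∀ i, 0 ≤ l i) (hδ : 0 < δ)
    (hy : ∀ (μ : ℝ) (v : U → ℝ), (∀ j, l j ≠ μ → v j = 0) → ∑ j, v j • y j = 0 → v = 0)
    {v : U → ℝ} (hv : gramMatrix l y δ *ᵥ v = 0) : v = 0 := by
  classical
  -- By invariance, polynomials in `diag(l)` preserve the kernel. The product over all values of `l`
  -- other than `l i` isolates the block of `v` with that value, to which `hy` applies.
  have hprod : ∀ s : Finset ℝ,
      gramMatrix l y δ *ᵥ (fun j => (∏ μ ∈ s, (l j - μ)) * v j) = 0 := by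
    intro s
    induction s using Finset.induction_on with
    | empty => simpa using hv
    | insert μ s hμ ih =>
      have := gramMatrix_mulVec_mul_sub hl hδ ih μ
      simpa only [Finset.prod_insert hμ, mul_assoc] using this
  funext i
  have h := hy (l i) _ (fun j hj => ?_) (sum_smul_eq_zero_of_gramMatrix hl hδ
    (hprod ((Finset.univ.image l).erase (l i))))
  · have := congrFun h i
    simp only [Pi.zero_apply, mul_eq_zero] at this
    refine this.resolve_left (Finset.prod_ne_zero_iff.2 fun μ hμ => ?_)
    exact sub_ne_zero.2 (Finset.ne_of_mem_erase hμ).symm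
  · rw [Finset.prod_eq_zero (i := l j) _ (sub_self _), zero_mul]
    exact Finset.mem_erase.2 ⟨hj, Finset.mem_image_of_mem l (Finset.mem_univ j)⟩

end Gram

/-! ### Output feedback for diagonal operators -/

section Feedback

open scoped Matrix

variable {K X : Type*} [NormedAddCommGroup X] [InnerProductSpace ℝ X]

/-- `A` is the (maximal) diagonal operator with eigenvalues `lam` in the Hilbert basis `b`. -/
def IsDiagonal (A : X →ₗ.[ℝ] X) (b : HilbertBasis K ℝ X) (lam : K → ℝ) : Prop :=
  ∀ x z, (x, z) ∈ A.graph ↔ ∀ k, ⟪b k, z⟫_ℝ = lam k * ⟪b k, x⟫_ℝ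

variable {A : X →ₗ.[ℝ] X} {b : HilbertBasis K ℝ X} {lam : K → ℝ} {q : ℕ}
  {C : A.domain →ₗ[ℝ] (Fin q → ℝ)}

lemma IsDiagonal.inner_apply (hA : IsDiagonal A b lam) (x : A.domain) (k : K) :
    ⟪b k, A x⟫_ℝ = lam k * ⟪b k, (x : X)⟫_ℝ :=
  (hA _ _).1 (A.mem_graph x) k

lemma IsDiagonal.exists_apply_eq (hA : IsDiagonal A b lam) {x z : X}
    (h : ∀ k, ⟪b k, z⟫_ℝ = lam k * ⟪b k, x⟫_ℝ) : ∃ hx : x ∈ A.domain, A ⟨x, hx⟩ = z := by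
  obtain ⟨x', h1, h2⟩ := A.mem_graph_iff.1 ((hA x z).2 h)
  simp only at h1 h2
  subst h1
  exact ⟨x'.2, h2⟩

lemma IsDiagonal.diag_mem (hA : IsDiagonal A b lam) {d : K → ℝ} (hd : ∃ M, ∀ k, |d k| ≤ M)
    (hd' : ∃ M, ∀ k, |lam k * d k| ≤ M) (x : X) :
    ∃ hx : diag b d x ∈ A.domain, A ⟨diag b d x, hx⟩ = diag b (fun k => lam k * d k) x :=
  hA.exists_apply_eq fun k => by rw [inner_diag hd', inner_diag hd, mul_assoc]

lemma IsDiagonal.basis_mem (hA : IsDiagonal A b lam) (j : K) :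
    ∃ hx : b j ∈ A.domain, A ⟨b j, hx⟩ = lam j • b j :=
  hA.exists_apply_eq fun k => by
    classical
    rw [inner_smul_right, inner_basis]
    split_ifs with h
    · rw [h]
    · simp

/-- The output is bounded only for the graph norm, but it becomes bounded on all of `X` after a
diagonal operator that maps `X` boundedly into the domain. This is used with resolvents of `A`. -/
lemma IsDiagonal.exists_output (hA : IsDiagonal A b lam)
    (hC : ∃ c : ℝ, ∀ x : A.domain, ‖C x‖ ≤ c * (‖(x : X)‖ + ‖A x‖)) {d : K → ℝ}
    (hd : ∃ M, ∀ k, |d k| ≤ M) (hd' : ∃ M, ∀ k, |lam k * d k| ≤ M) :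
    ∃ L : X →L[ℝ] (Fin q → ℝ), ∀ x (hx : diag b d x ∈ A.domain), L x = C ⟨diag b d x, hx⟩ := by
  obtain ⟨c, hc⟩ := hC
  obtain ⟨M, hM⟩ := id hd
  obtain ⟨M', hM'⟩ := id hd'
  have hmem := fun x => (hA.diag_mem hd hd' x).choose
  have happ := fun x => (hA.diag_mem hd hd' x).choose_spec
  let T : X →ₗ[ℝ] A.domain := (diag b d : X →ₗ[ℝ] X).codRestrict A.domain hmem
  refine ⟨(C ∘ₗ T).mkContinuous (|c| * (|M| + |M'|)) fun x => ?_, fun x hx => rfl⟩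
  have h1 : ‖diag b d x‖ ≤ |M| * ‖x‖ :=
    norm_diag_apply_le (abs_nonneg _) (fun k => (hM k).trans (le_abs_self _)) x
  have h2 : ‖A (T x)‖ ≤ |M'| * ‖x‖ := by
    rw [show A (T x) = _ from happ x]
    exact norm_diag_apply_le (abs_nonneg _) (fun k => (hM' k).trans (le_abs_self _)) x
  have h3 : ‖diag b d x‖ + ‖A (T x)‖ ≤ (|M| + |M'|) * ‖x‖ := by rw [add_mul]; exact add_le_add h1 h2
  calc ‖C (T x)‖ ≤ c * (‖diag b d x‖ + ‖A (T x)‖) := hc (T x)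
    _ ≤ |c| * (‖diag b d x‖ + ‖A (T x)‖) := by gcongr; exact le_abs_self c
    _ ≤ |c| * ((|M| + |M'|) * ‖x‖) := by gcongr
    _ = _ := by ring

lemma exists_pos_le_of_finite {f : K → ℝ} (hpos : ∀ k, 0 < f k) (hfin : {k | f k < 1}.Finite) :
    ∃ c, 0 < c ∧ ∀ k, c ≤ f k := by
  rcases {k | f k < 1}.eq_empty_or_nonempty with h | h
  · refine ⟨1, one_pos, fun k => not_lt.1 fun hk => ?_⟩
    exact (Set.eq_empty_iff_forall_notMem.1 h k) hk
  · obtain ⟨j, hj, hmin⟩ := Set.exists_min_image _ f hfin h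
    refine ⟨f j, hpos j, fun k => ?_⟩
    by_cases hk : f k < 1
    · exact hmin k hk
    · exact (hj : f j < 1).le.trans (not_lt.1 hk)

/-- The shifted operators `A + (lam i + 2δ)` must be invertible for every `i ∈ U`. Inside `(0, 1)`
this excludes only finitely many `δ = -(lam k + lam i) / 2`, since `lam k ≥ -(lam i + 2)` for only
finitely many `k`. -/
lemma exists_shift (hfin : ∀ N, {k | N ≤ lam k}.Finite) (U : Finset K) :
    ∃ δ : ℝ, 0 < δ ∧ ∀ i ∈ U, ∀ k, lam k + (lam i + 2 * δ) ≠ 0 := by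
  have hbad : (⋃ i ∈ U, (fun k => -(lam k + lam i) / 2) '' {k | -(lam i + 2) ≤ lam k}).Finite :=
    Set.Finite.biUnion U.finite_toSet fun i _ => (hfin _).image _
  obtain ⟨δ, hδ, hδ'⟩ := (Set.Ioo_infinite (zero_lt_one' ℝ)).exists_notMem_finite hbad
  refine ⟨δ, hδ.1, fun i hi k h0 => hδ' ?_⟩
  refine Set.mem_biUnion hi ⟨k, ?_, ?_⟩
  · change -(lam i + 2) ≤ lam k
    linarith [hδ.2]
  · simp only
    linarith

/-- Only finitely many `lam k` lie within distance `1` of `-κ`, so `|lam k + κ|` is bounded below by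
a positive constant. -/
lemma bounded_resolvent (hfin : ∀ N, {k | N ≤ lam k}.Finite) {κ : ℝ}
    (h0 : ∀ k, lam k + κ ≠ 0) :
    (∃ M, ∀ k, |(lam k + κ)⁻¹| ≤ M) ∧ ∃ M, ∀ k, |lam k * (lam k + κ)⁻¹| ≤ M := by
  obtain ⟨c, hc, hle⟩ := exists_pos_le_of_finite (f := fun k => |lam k + κ|)
    (fun k => abs_pos.2 (h0 k)) ((hfin (-κ - 1)).subset fun k hk => by
      have hk' : |lam k + κ| < 1 := hk
      have := (abs_lt.1 hk').1
      change -κ - 1 ≤ lam k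
      linarith)
  have h1 : ∀ k, |(lam k + κ)⁻¹| ≤ c⁻¹ := fun k => by
    rw [abs_inv]
    exact inv_anti₀ hc (hle k)
  refine ⟨⟨c⁻¹, h1⟩, 1 + |κ| * c⁻¹, fun k => ?_⟩
  have : lam k * (lam k + κ)⁻¹ = 1 - κ * (lam k + κ)⁻¹ := by
    have := h0 k
    field_simp
    ring
  rw [this]
  calc |1 - κ * (lam k + κ)⁻¹| ≤ |1| + |κ * (lam k + κ)⁻¹| := abs_sub _ _
    _ ≤ 1 + |κ| * c⁻¹ := by
      rw [abs_one, abs_mul]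
      gcongr
      exact h1 k

lemma mem_graph_closedLoop {H : (Fin q → ℝ) →L[ℝ] X} {x y : X} :
    (x, y) ∈ (closedLoop A C H).graph ↔ ∃ hx : x ∈ A.domain, A ⟨x, hx⟩ - H (C ⟨x, hx⟩) = y := by
  rw [LinearPMap.mem_graph_iff]
  constructor
  · rintro ⟨⟨x', hx'⟩, h1, h2⟩
    simp only at h1 h2
    subst h1
    exact ⟨hx', h2⟩
  · rintro ⟨hx, h⟩
    exact ⟨⟨x, hx⟩, rfl, h⟩

/-- If no eigenvector for a non-negative eigenvalue is invisible to `C`, then there is a feedback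
`H` such that `A - H C` is conjugate to a diagonal operator with spectrum in `(-∞, -γ]`, by an
isomorphism which changes only finitely many coordinates. -/
theorem IsDiagonal.exists_feedback [CompleteSpace X] (hA : IsDiagonal A b lam)
    (hfin : ∀ N, {k | N ≤ lam k}.Finite)
    (hC : ∃ c : ℝ, ∀ x : A.domain, ‖C x‖ ≤ c * (‖(x : X)‖ + ‖A x‖))
    (hautus : ∀ (μ : ℝ) (x : A.domain), 0 ≤ μ → A x = μ • (x : X) → C x = 0 → x = 0) :
    ∃ (H : (Fin q → ℝ) →L[ℝ] X) (U : Finset K) (σ : K → ℝ) (γ : ℝ) (Θ : X ≃L[ℝ] X),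
      0 < γ ∧ (∀ k, σ k ≤ -γ) ∧ (∀ k ∉ U, σ k = lam k) ∧ (∀ k ∈ U, 0 ≤ lam k) ∧
      (∀ x, ∀ k ∉ U, ⟪b k, Θ x⟫_ℝ = ⟪b k, x⟫_ℝ) ∧
      ∀ x y, (x, y) ∈ (closedLoop A C H).graph ↔ ∀ k, ⟪b k, Θ y⟫_ℝ = σ k * ⟪b k, Θ x⟫_ℝ := by
  classical
  set U : Finset K := (hfin 0).toFinset with hUdef
  have hU : ∀ k, k ∈ U ↔ 0 ≤ lam k := fun k => by simp [hUdef]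
  obtain ⟨δ, hδ, hshift⟩ := exists_shift hfin U
  obtain ⟨γ₀, hγ₀, hγle⟩ := exists_pos_le_of_finite
    (f := fun k => if k ∈ U then 1 else -lam k)
    (fun k => by
      split_ifs with h
      · exact one_pos
      · rw [hU, not_le] at h
        linarith)
    ((hfin (-1)).subset fun k hk => by
      change (if k ∈ U then 1 else -lam k) < 1 at hk
      change -1 ≤ lam k
      split_ifs at hk with h
      · exact absurd hk (lt_irrefl _)
      · linarith)
  choose hbm hAb using hA.basis_mem
  set y : U → Fin q → ℝ := fun i => C ⟨b i, hbm i⟩ with hy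
  have hres := fun i : U => bounded_resolvent hfin (hshift i i.2)
  choose L hL using fun i : U => hA.exists_output hC (hres i).1 (hres i).2
  -- This says `L i = C (A + lam i + 2δ)⁻¹`, now bounded on all of `X`.
  have hLA : ∀ (i : U) (x : A.domain), L i (A x + (lam i + 2 * δ) • (x : X)) = C x := by
    intro i x
    have e : diag b (fun k => (lam k + (lam i + 2 * δ))⁻¹) (A x + (lam i + 2 * δ) • (x : X)) = x :=
      hilbertBasis_ext b fun k => by
        rw [inner_diag (hres i).1, inner_add_right, inner_smul_right, hA.inner_apply, ← add_mul,
          inv_mul_cancel_left₀ (hshift i i.2 k)]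
    have hx : diag b (fun k => (lam k + (lam i + 2 * δ))⁻¹) (A x + (lam i + 2 * δ) • (x : X)) ∈
        A.domain := by
      rw [e]
      exact x.2
    rw [hL i _ hx]
    congr 1
    exact Subtype.ext e
  -- These become the left eigenvectors of the closed loop: `hLA` gives `w i (A x) + (lam i + 2δ) w
  -- i x = y i · C x`.
  let w : U → X →L[ℝ] ℝ := fun i =>
    ∑ p, y i p • (ContinuousLinearMap.proj (R := ℝ) (φ := fun _ : Fin q => ℝ) p).comp (L i)
  have hw : ∀ i x, w i x = ∑ p, y i p * L i x p := fun i x => by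
    simp [w, _root_.sum_apply]
  set W := gramMatrix (fun i : U => lam i) y δ with hWdef
  have hwb : ∀ i j : U, w i (b j) = W i j := by
    intro i j
    have h1 : L i (b j) = (lam j + (lam i + 2 * δ))⁻¹ • y j := by
      have hne := hshift i i.2 j
      have h2 := hLA i ⟨b j, hbm j⟩
      rw [hAb, ← add_smul, map_smul] at h2
      rw [show y j = C ⟨b j, hbm j⟩ from rfl, ← h2, smul_smul, inv_mul_cancel₀ hne, one_smul]
    rw [hw, h1, hWdef, gramMatrix, Matrix.of_apply, Finset.sum_div]
    refine Finset.sum_congr rfl fun p _ => ?_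
    rw [Pi.smul_apply, smul_eq_mul]
    ring
  -- A vanishing combination of the `y j` with one common eigenvalue is an eigenvector in the kernel
  -- of `C`, which `hautus` excludes.
  have hWinj : Function.Injective W.mulVec := by
    refine (injective_iff_map_eq_zero W.mulVecLin).2 fun v hv => ?_
    refine gramMatrix_mulVec_injective (l := fun i : U => lam i) (fun i => (hU i).1 i.2) hδ (fun μ v hμ hsum => ?_) hv
    by_cases hex : ∃ i, lam (i : U) = μ
    · obtain ⟨i, rfl⟩ := hex
      have hx := hautus (lam i) (∑ j : U, v j • ⟨b j, hbm j⟩) ((hU i).1 i.2) (by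
        rw [← LinearPMap.toFun_eq_coe, map_sum]
        simp only [map_smul, LinearPMap.toFun_eq_coe, hAb, Submodule.coe_sum, Submodule.coe_smul,
          Finset.smul_sum]
        refine Finset.sum_congr rfl fun j _ => ?_
        by_cases hj : lam j = lam i
        · rw [hj, smul_comm]
        · simp [hμ j hj]) (by
        rw [map_sum]
        simpa only [map_smul] using hsum)
      have hx2 := congrArg (fun z : A.domain => (z : X)) hx
      simp only [Submodule.coe_sum, Submodule.coe_smul, Submodule.coe_zero] at hx2
      funext j
      have := congrArg (fun z => ⟪b j, z⟫_ℝ) hx2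
      simpa [inner_sum, inner_smul_right, inner_basis, Subtype.coe_inj] using this
    · push Not at hex
      funext j
      exact hμ j (hex j)
  have hWunit : IsUnit W := Matrix.mulVec_injective_iff_isUnit.1 hWinj
  have hWW : W * W⁻¹ = 1 := Matrix.mul_nonsing_inv W ((Matrix.isUnit_iff_isUnit_det W).1 hWunit)
  let E : (U → ℝ) →ₗ[ℝ] X := ∑ j : U, (LinearMap.proj j).smulRight (b j)
  have hE : ∀ v, E v = ∑ j : U, v j • b j := fun v => by
    simp [E, LinearMap.sum_apply]
  have hEin : ∀ v k, ⟪b k, E v⟫_ℝ = if h : k ∈ U then v ⟨k, h⟩ else 0 := by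
    intro v k
    rw [hE, inner_sum]
    simp only [inner_smul_right, inner_basis, mul_ite, mul_one, mul_zero]
    split_ifs with h
    · rw [Finset.sum_eq_single ⟨k, h⟩ (fun j _ hj => if_neg fun e => hj (Subtype.ext e.symm))
        (by simp), if_pos rfl]
    · exact Finset.sum_eq_zero fun j _ => if_neg (by rintro rfl; exact h j.2)
  have hwE : ∀ v i, w i (E v) = (W *ᵥ v) i := by
    intro v i
    rw [hE, map_sum]
    simp only [map_smul, hwb, smul_eq_mul]
    exact Finset.sum_congr rfl fun j _ => mul_comm _ _
  -- Chosen with values in the unstable modes so that `w i (H u) = y i · u`; this cancels the output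
  -- term in the relation for `w i`.
  let H : (Fin q → ℝ) →L[ℝ] X :=
    LinearMap.toContinuousLinearMap (E ∘ₗ (W⁻¹ * Matrix.of y).mulVecLin)
  have hH : ∀ u, H u = E (W⁻¹ *ᵥ (Matrix.of y *ᵥ u)) := fun u => by
    simp [H, Matrix.mulVec_mulVec]
  have hwH : ∀ i u, w i (H u) = ∑ p, y i p * u p := by
    intro i u
    rw [hH, hwE, Matrix.mulVec_mulVec, hWW, Matrix.one_mulVec]
    rfl
  -- The change of coordinates: the `i`-th coordinate, `i ∈ U`, becomes `w i x`, and all others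
  -- stay.
  let Θ₀ : X →L[ℝ] X := ContinuousLinearMap.id ℝ X +
    ∑ i : U, (w i - innerSL ℝ (b i)).smulRight (b i)
  have hΘ₀ : ∀ x, Θ₀ x = x + E fun i => w i x - ⟪b i, x⟫_ℝ := fun x => by
    simp [Θ₀, hE, _root_.sum_apply]
  have hin : ∀ x (i : U), ⟪b i, Θ₀ x⟫_ℝ = w i x := fun x i => by
    rw [hΘ₀, inner_add_right, hEin, dif_pos i.2]
    ring
  have hout : ∀ x, ∀ k ∉ U, ⟪b k, Θ₀ x⟫_ℝ = ⟪b k, x⟫_ℝ := fun x k hk => by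
    rw [hΘ₀, inner_add_right, hEin, dif_neg hk, add_zero]
  have hrep : ∀ x, (∀ k ∉ U, ⟪b k, x⟫_ℝ = 0) → x = E fun i => ⟪b i, x⟫_ℝ := fun x hx =>
    hilbertBasis_ext b fun k => by
      rw [hEin]
      split_ifs with h
      · rfl
      · exact hx k h
  have hker : Θ₀.ker = ⊥ := by
    refine LinearMap.ker_eq_bot'.2 fun x hx => ?_
    have hx' : Θ₀ x = 0 := hx
    have e := hrep x fun k hk => by rw [← hout x k hk, hx', inner_zero_right]
    have h0 : (fun i : U => ⟪b i, x⟫_ℝ) = 0 := by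
      refine hWinj ?_
      funext i
      rw [← hwE, ← e, ← hin, hx', inner_zero_right, Matrix.mulVec_zero, Pi.zero_apply]
    rw [e, h0, map_zero]
  have hrange : Θ₀.range = ⊤ := by
    refine LinearMap.range_eq_top.2 fun z => ?_
    set s := z - E fun i => ⟪b i, z⟫_ℝ with hs
    have hsU : ∀ i : U, ⟪b i, s⟫_ℝ = 0 := fun i => by
      rw [hs, inner_sub_right, hEin, dif_pos i.2, sub_self]
    have hsU' : ∀ k ∉ U, ⟪b k, s⟫_ℝ = ⟪b k, z⟫_ℝ := fun k hk => by
      rw [hs, inner_sub_right, hEin, dif_neg hk, sub_zero]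
    -- The coordinates outside `U` are prescribed by `s`; the part in the span of `U` then solves a
    -- linear system with matrix `W`.
    refine ⟨s + E (W⁻¹ *ᵥ fun i => ⟪b i, z⟫_ℝ - w i s), hilbertBasis_ext b fun k => ?_⟩
    by_cases hk : k ∈ U
    · refine (hin _ ⟨k, hk⟩).trans ?_
      rw [map_add, hwE, Matrix.mulVec_mulVec, hWW, Matrix.one_mulVec]
      ring
    · refine (hout _ k hk).trans ?_
      rw [inner_add_right, hEin, dif_neg hk, add_zero, hsU' k hk]
  let Θ := ContinuousLinearEquiv.ofBijective Θ₀ hker hrange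
  have hΘ : ∀ x, Θ x = Θ₀ x := fun x => rfl
  have hHout : ∀ u, ∀ k ∉ U, ⟪b k, H u⟫_ℝ = 0 := fun u k hk => by
    rw [hH, hEin, dif_neg hk]
  have hcl : ∀ (x : A.domain) k, ⟪b k, Θ (A x - H (C x))⟫_ℝ =
      (if k ∈ U then -(lam k + 2 * δ) else lam k) * ⟪b k, Θ x⟫_ℝ := by
    intro x k
    rw [hΘ, hΘ]
    split_ifs with hk
    · have h1 := hin (A x - H (C x)) ⟨k, hk⟩
      have h2 := hin x ⟨k, hk⟩
      simp only at h1 h2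
      rw [h1, h2, map_sub, hwH, ← hLA ⟨k, hk⟩ x, ← hw, map_add, map_smul, smul_eq_mul]
      ring
    · rw [hout _ k hk, hout _ k hk, inner_sub_right, hHout _ k hk, hA.inner_apply, sub_zero]
  refine ⟨H, U, fun k => if k ∈ U then -(lam k + 2 * δ) else lam k, min γ₀ (2 * δ), Θ,
    lt_min hγ₀ (by linarith), fun k => ?_, fun k hk => if_neg hk, fun k hk => (hU k).1 hk,
    fun x k hk => hout x k hk, fun x y => ?_⟩
  · have h1 := hγle k
    simp only at h1 ⊢
    split_ifs at h1 ⊢ with hk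
    · have := (hU k).1 hk
      linarith [min_le_right γ₀ (2 * δ)]
    · linarith [min_le_left γ₀ (2 * δ)]
  · rw [mem_graph_closedLoop]
    constructor
    · rintro ⟨hx, rfl⟩ k
      exact hcl ⟨x, hx⟩ k
    · intro h
      -- Membership in the domain of `A` depends only on the coordinates outside `U`, where `Θ`
      -- changes nothing and `σ = lam`; the finitely many remaining coordinates of the candidate for
      -- `A x` are corrected by hand.
      obtain ⟨hx, -⟩ := hA.exists_apply_eq (x := x)
        (z := Θ y + E fun i => lam i * ⟪b i, x⟫_ℝ - ⟪b i, Θ y⟫_ℝ) fun k => by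
          rw [inner_add_right, hEin]
          split_ifs with hk
          · ring
          · rw [h k, hΘ, hout _ k hk, add_zero]
            simp only [if_neg hk]
      refine ⟨hx, Θ.injective (hilbertBasis_ext b fun k => ?_)⟩
      rw [hcl ⟨x, hx⟩ k, h k]

end Feedback

/-! ### Decay in the energy norm -/

section Energy

variable {K X V : Type*} [NormedAddCommGroup X] [InnerProductSpace ℝ X]
  [NormedAddCommGroup V] [NormedSpace ℝ V]

/-- The domain of `A` embeds into the energy space `V`, on which the form `⟪(c₀ - A) x, ·⟫` is
coercive and bounded. -/
def HasEnergy (A : X →ₗ.[ℝ] X) (ι : V →L[ℝ] X) (c₀ α β : ℝ) : Prop :=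
  ∀ x z, (x, z) ∈ A.graph → ∃ v, ι v = x ∧ α * ‖v‖ ^ 2 ≤ ⟪c₀ • x - z, x⟫_ℝ ∧
    ∀ v', ⟪c₀ • x - z, ι v'⟫_ℝ ≤ β * ‖v‖ * ‖v'‖

variable {A : X →ₗ.[ℝ] X} {b : HilbertBasis K ℝ X} {lam σ : K → ℝ} {U : Finset K}
  {ι : V →L[ℝ] X} {c₀ α β γ : ℝ}

lemma IsDiagonal.basis_mem_graph (hA : IsDiagonal A b lam) (j : K) :
    (b j, lam j • b j) ∈ A.graph := by
  obtain ⟨hx, h⟩ := hA.basis_mem j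
  rw [← h]
  exact A.mem_graph ⟨b j, hx⟩

/-- Coercivity tested on the eigenvector `b k`. -/
lemma HasEnergy.le_shift (hE : HasEnergy A ι c₀ α β) (hα : 0 ≤ α) (hA : IsDiagonal A b lam)
    (k : K) : 0 ≤ c₀ - lam k := by
  obtain ⟨v, -, h, -⟩ := hE _ _ (hA.basis_mem_graph k)
  rw [← sub_smul, inner_smul_left, real_inner_self_eq_norm_sq, b.orthonormal.1 k] at h
  simp only [conj_trivial, one_pow, mul_one] at h
  exact le_trans (by positivity) h

lemma mul_exp_neg_le {t s : ℝ} (ht : 0 < t) : s * Real.exp (t * -s) ≤ 1 / t := by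
  have h1 := Real.add_one_le_exp (t * s)
  have h2 : t * s ≤ Real.exp (t * s) := by linarith
  rw [le_div_iff₀ ht, mul_neg, Real.exp_neg, mul_comm, ← mul_assoc]
  exact mul_inv_le_one_of_le₀ h2 (Real.exp_pos _).le

/-- The multiplier of `(c₀ - A) e^{tΣ}`. -/
def energyMultiplier (c₀ : ℝ) (lam σ : K → ℝ) (t : ℝ) (k : K) : ℝ :=
  (c₀ - lam k) * Real.exp (t * σ k)

/-- Parabolic smoothing. On `U` the eigenvalue is non-negative, so the factor `c₀ - lam k` is at
most `c₀`; off `U` the exponential has the same exponent `lam k = σ k`, and `-s e^{ts} ≤ 1 / t`. -/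
lemma abs_energyMultiplier_le (hle : ∀ k, 0 ≤ c₀ - lam k) (hc₀ : 0 ≤ c₀) (hγ : 0 ≤ γ)
    (hσ : ∀ k, σ k ≤ -γ) (hσU : ∀ k ∉ U, σ k = lam k) (hU : ∀ k ∈ U, 0 ≤ lam k)
    {t : ℝ} (ht : 0 < t) (k : K) : |energyMultiplier c₀ lam σ t k| ≤ c₀ + 1 / t := by
  have h1 : Real.exp (t * σ k) ≤ 1 :=
    Real.exp_le_one_iff.2 (mul_nonpos_of_nonneg_of_nonpos ht.le (by linarith [hσ k]))
  have h2 := Real.exp_pos (t * σ k)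
  rw [energyMultiplier, abs_of_nonneg (mul_nonneg (hle k) h2.le)]
  have ht' : 0 < 1 / t := by positivity
  by_cases hk : k ∈ U
  · calc (c₀ - lam k) * Real.exp (t * σ k) ≤ (c₀ - lam k) * 1 :=
        mul_le_mul_of_nonneg_left h1 (hle k)
      _ ≤ c₀ + 1 / t := by linarith [hU k hk]
  · have h3 := mul_exp_neg_le (s := -σ k) ht
    rw [neg_neg] at h3
    rw [← hσU k hk]
    calc (c₀ - σ k) * Real.exp (t * σ k) = c₀ * Real.exp (t * σ k) + -σ k * Real.exp (t * σ k) := by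
          ring
      _ ≤ c₀ * 1 + 1 / t := add_le_add (mul_le_mul_of_nonneg_left h1 hc₀) h3
      _ = c₀ + 1 / t := by ring

lemma abs_exp_le_exp_neg (hσ : ∀ k, σ k ≤ -γ) {t : ℝ} (ht : 0 ≤ t) (k : K) :
    |Real.exp (t * σ k)| ≤ Real.exp (-γ * t) := by
  rw [abs_of_pos (Real.exp_pos _), mul_comm (-γ)]
  exact Real.exp_le_exp.2 (mul_le_mul_of_nonneg_left (hσ k) ht)

/-- For `t > 0` the multiplier is bounded, so `e^{tΣ} y` lies in the domain of `A`, and `(c₀ - A)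
e^{tΣ} y` is the diagonal operator `energyMultiplier` applied to `y`. `HasEnergy` therefore applies
for every `y` in `X`. -/
lemma IsDiagonal.exists_energy (hA : IsDiagonal A b lam) (hE : HasEnergy A ι c₀ α β)
    (hα : 0 < α) (hc₀ : 0 ≤ c₀) (hγ : 0 ≤ γ)
    (hσ : ∀ k, σ k ≤ -γ) (hσU : ∀ k ∉ U, σ k = lam k) (hU : ∀ k ∈ U, 0 ≤ lam k)
    {t : ℝ} (ht : 0 < t) (y : X) :
    ∃ v, ι v = diag b (fun k => Real.exp (t * σ k)) y ∧
      α * ‖v‖ ^ 2 ≤ ⟪diag b (energyMultiplier c₀ lam σ t) y,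
        diag b (fun k => Real.exp (t * σ k)) y⟫_ℝ ∧
      ∀ v', ⟪diag b (energyMultiplier c₀ lam σ t) y, ι v'⟫_ℝ ≤ β * ‖v‖ * ‖v'‖ := by
  have hm : ∃ M, ∀ k, |energyMultiplier c₀ lam σ t k| ≤ M :=
    ⟨_, abs_energyMultiplier_le (hE.le_shift hα.le hA) hc₀ hγ hσ hσU hU ht⟩
  have hb : ∃ M, ∀ k, |Real.exp (t * σ k)| ≤ M := ⟨_, abs_exp_le_exp_neg hσ ht.le⟩
  have hg : (diag b (fun k => Real.exp (t * σ k)) y,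
      c₀ • diag b (fun k => Real.exp (t * σ k)) y - diag b (energyMultiplier c₀ lam σ t) y) ∈
      A.graph := (hA _ _).2 fun k => by
    rw [inner_sub_right, inner_smul_right, inner_diag hb, inner_diag hm, energyMultiplier]
    ring
  obtain ⟨v, h1, h2, h3⟩ := hE _ _ hg
  rw [sub_sub_cancel] at h2 h3
  exact ⟨v, h1, h2, h3⟩

lemma IsDiagonal.energy_smoothing (hA : IsDiagonal A b lam) (hE : HasEnergy A ι c₀ α β)
    (hα : 0 < α) (hc₀ : 0 ≤ c₀) (hγ : 0 ≤ γ)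
    (hσ : ∀ k, σ k ≤ -γ) (hσU : ∀ k ∉ U, σ k = lam k) (hU : ∀ k ∈ U, 0 ≤ lam k)
    {t : ℝ} (ht : 0 < t) (y : X) :
    ∃ v, ι v = diag b (fun k => Real.exp (t * σ k)) y ∧
      α * ‖v‖ ^ 2 ≤ (c₀ + 1 / t) * Real.exp (-γ * t) * ‖y‖ ^ 2 := by
  obtain ⟨v, h1, h2, -⟩ := hA.exists_energy hE hα hc₀ hγ hσ hσU hU ht y
  refine ⟨v, h1, h2.trans ((real_inner_le_norm _ _).trans ?_)⟩
  have hpos : 0 ≤ c₀ + 1 / t := by positivity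
  have h3 := norm_diag_apply_le (b := b) hpos
    (abs_energyMultiplier_le (hE.le_shift hα.le hA) hc₀ hγ hσ hσU hU ht) y
  have h4 := norm_diag_apply_le (b := b) (Real.exp_pos _).le (abs_exp_le_exp_neg hσ ht.le) y
  calc _ ≤ (c₀ + 1 / t) * ‖y‖ * (Real.exp (-γ * t) * ‖y‖) :=
        mul_le_mul h3 h4 (norm_nonneg _) (by positivity)
    _ = _ := by ring

/-- Let `φ(t) = ⟪(c₀ - A) e^{tΣ} u, e^{tΣ} u⟫`, and let `w` be the lift of `e^{2tΣ} u` to `V`.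
Moving one exponential across gives `φ(t) = ⟪(c₀ - A) e^{2tΣ} u, u⟫ ≤ β ‖w‖ ‖u‖`, while `α ‖w‖² ≤
φ(2t) ≤ e^{-2γt} φ(t)`. Together `α φ(t) ≤ (β e^{-γt} ‖u‖)²`, and `α ‖v‖² ≤ φ(t)`. The form of `u`
is thus never expanded in the eigenbasis at `t = 0`. -/
lemma IsDiagonal.energy_decay (hA : IsDiagonal A b lam) (hE : HasEnergy A ι c₀ α β)
    (hα : 0 < α) (hβ : 0 ≤ β) (hc₀ : 0 ≤ c₀) (hγ : 0 ≤ γ)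
    (hσ : ∀ k, σ k ≤ -γ) (hσU : ∀ k ∉ U, σ k = lam k) (hU : ∀ k ∈ U, 0 ≤ lam k)
    {t : ℝ} (ht : 0 < t) (u : V) :
    ∃ v, ι v = diag b (fun k => Real.exp (t * σ k)) (ι u) ∧
      ‖v‖ ≤ β / α * Real.exp (-γ * t) * ‖u‖ := by
  have hle := hE.le_shift hα.le hA
  have ht2 : 0 < t + t := by linarith
  have hm : ∀ {s : ℝ}, 0 < s → ∃ M, ∀ k, |energyMultiplier c₀ lam σ s k| ≤ M := fun hs =>
    ⟨_, abs_energyMultiplier_le hle hc₀ hγ hσ hσU hU hs⟩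
  have hb : ∀ {s : ℝ}, 0 < s → ∃ M, ∀ k, |Real.exp (s * σ k)| ≤ M := fun hs =>
    ⟨_, abs_exp_le_exp_neg hσ hs.le⟩
  obtain ⟨v, hv, h1, -⟩ := hA.exists_energy hE hα hc₀ hγ hσ hσU hU ht (ι u)
  obtain ⟨w, hw, h2, h3⟩ := hA.exists_energy hE hα hc₀ hγ hσ hσU hU ht2 (ι u)
  refine ⟨v, hv, ?_⟩
  have hsum : ∀ {s : ℝ}, 0 < s → HasSum
      (fun k => (c₀ - lam k) * ⟪b k, ι u⟫_ℝ ^ 2 * Real.exp ((s + s) * σ k))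
      ⟪diag b (energyMultiplier c₀ lam σ s) (ι u),
        diag b (fun k => Real.exp (s * σ k)) (ι u)⟫_ℝ := by
    intro s hs
    refine (inner_diag_eq_tsum (hm hs) _ _).congr_fun fun k => ?_
    rw [inner_diag (hb hs), energyMultiplier, add_mul, Real.exp_add]
    ring
  have hsum' : HasSum
      (fun k => (c₀ - lam k) * ⟪b k, ι u⟫_ℝ ^ 2 * Real.exp ((t + t) * σ k))
      ⟪diag b (energyMultiplier c₀ lam σ (t + t)) (ι u), ι u⟫_ℝ := by
    refine (inner_diag_eq_tsum (hm ht2) _ _).congr_fun fun k => ?_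
    rw [energyMultiplier]
    ring
  set φ := ⟪diag b (energyMultiplier c₀ lam σ t) (ι u),
    diag b (fun k => Real.exp (t * σ k)) (ι u)⟫_ℝ with hφ
  have e1 : φ ≤ β * ‖w‖ * ‖u‖ := by
    exact ((hsum ht).unique hsum').le.trans (h3 u)
  have e2 : α * ‖w‖ ^ 2 ≤ Real.exp (-γ * t) ^ 2 * φ := by
    refine h2.trans (hasSum_le (fun k => ?_) (hsum ht2) ((hsum ht).mul_left _))
    have h4 : Real.exp ((t + t + (t + t)) * σ k) ≤
        Real.exp (-γ * t) ^ 2 * Real.exp ((t + t) * σ k) := by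
      rw [← Real.exp_nat_mul, ← Real.exp_add]
      refine Real.exp_le_exp.2 ?_
      have := mul_le_mul_of_nonneg_left (hσ k) ht2.le
      push_cast
      linarith
    have h5 : 0 ≤ (c₀ - lam k) * ⟪b k, ι u⟫_ℝ ^ 2 := mul_nonneg (hle k) (sq_nonneg _)
    calc _ ≤ (c₀ - lam k) * ⟪b k, ι u⟫_ℝ ^ 2 *
          (Real.exp (-γ * t) ^ 2 * Real.exp ((t + t) * σ k)) := mul_le_mul_of_nonneg_left h4 h5
      _ = _ := by ring
  have hφ0 : 0 ≤ φ := le_trans (by positivity) h1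
  -- From `φ² ≤ (β ‖w‖ ‖u‖)²` and the bound for `α ‖w‖²` by `φ`, one factor `φ` is cancelled; hence
  -- the separate case `φ = 0`.
  have e3 : α * φ ≤ (β * Real.exp (-γ * t) * ‖u‖) ^ 2 := by
    rcases hφ0.eq_or_lt with h0 | h0
    · rw [← h0, mul_zero]
      positivity
    · refine le_of_mul_le_mul_right ?_ h0
      calc α * φ * φ ≤ α * (β * ‖w‖ * ‖u‖ * (β * ‖w‖ * ‖u‖)) := by
            rw [mul_assoc]
            exact mul_le_mul_of_nonneg_left (mul_self_le_mul_self hφ0 e1) hα.le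
        _ = (α * ‖w‖ ^ 2) * (β * ‖u‖) ^ 2 := by ring
        _ ≤ (Real.exp (-γ * t) ^ 2 * φ) * (β * ‖u‖) ^ 2 :=
            mul_le_mul_of_nonneg_right e2 (sq_nonneg _)
        _ = _ := by ring
  have e4 : (α * ‖v‖) ^ 2 ≤ (β * Real.exp (-γ * t) * ‖u‖) ^ 2 := by
    calc (α * ‖v‖) ^ 2 = α * (α * ‖v‖ ^ 2) := by ring
      _ ≤ α * φ := mul_le_mul_of_nonneg_left h1 hα.le
      _ ≤ _ := e3
  have e5 := abs_le_of_sq_le_sq e4 (by positivity)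
  have e6 := (le_abs_self _).trans e5
  rw [div_mul_eq_mul_div, div_mul_eq_mul_div, le_div_iff₀ hα]
  linarith

/-- `T - id` takes values in the span of finitely many eigenvectors, and these lie in `V`. So `T`
acts boundedly on `V`; this is applied to `Θ` and its inverse. -/
lemma IsDiagonal.exists_lift (hA : IsDiagonal A b lam) (hE : HasEnergy A ι c₀ α β)
    (T : X →L[ℝ] X) (hT : ∀ x, ∀ k ∉ U, ⟪b k, T x⟫_ℝ = ⟪b k, x⟫_ℝ) :
    ∃ c, 0 < c ∧ ∀ v, ∃ v', ι v' = T (ι v) ∧ ‖v'‖ ≤ c * ‖v‖ := by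
  choose e he using fun k => (hE _ _ (hA.basis_mem_graph k))
  refine ⟨1 + ∑ i ∈ U, ‖(T - ContinuousLinearMap.id ℝ X).comp ι‖ * ‖e i‖, by positivity,
    fun v => ⟨v + ∑ i ∈ U, ⟪b i, T (ι v) - ι v⟫_ℝ • e i, ?_, ?_⟩⟩
  · have h := eq_sum_of_inner_eq_zero b (U := U) (x := T (ι v) - ι v) fun k hk => by
      rw [inner_sub_right, hT _ k hk, sub_self]
    rw [map_add, map_sum]
    simp only [map_smul, (he _).1]
    rw [← h]
    abel
  · refine (norm_add_le _ _).trans ?_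
    rw [add_mul, one_mul, Finset.sum_mul]
    gcongr
    refine (norm_sum_le _ _).trans (Finset.sum_le_sum fun i _ => ?_)
    rw [norm_smul]
    have h1 : ‖⟪b i, T (ι v) - ι v⟫_ℝ‖ ≤ ‖(T - ContinuousLinearMap.id ℝ X).comp ι‖ * ‖v‖ := by
      refine (norm_inner_le_norm _ _).trans ?_
      rw [b.orthonormal.1 i, one_mul]
      exact ((T - ContinuousLinearMap.id ℝ X).comp ι).le_opNorm v
    calc _ ≤ ‖(T - ContinuousLinearMap.id ℝ X).comp ι‖ * ‖v‖ * ‖e i‖ := by gcongr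
      _ = _ := by ring

/-- Stabilization in the energy norm by output feedback. -/
theorem IsDiagonal.exists_stabilizing_feedback [CompleteSpace X] {q : ℕ}
    {C : A.domain →ₗ[ℝ] (Fin q → ℝ)} (hA : IsDiagonal A b lam)
    (hfin : ∀ N, {k | N ≤ lam k}.Finite)
    (hC : ∃ c : ℝ, ∀ x : A.domain, ‖C x‖ ≤ c * (‖(x : X)‖ + ‖A x‖))
    (hautus : ∀ (μ : ℝ) (x : A.domain), 0 ≤ μ → A x = μ • (x : X) → C x = 0 → x = 0)
    (hE : HasEnergy A ι c₀ α β) (hα : 0 < α) (hβ : 0 ≤ β) (hc₀ : 0 ≤ c₀) :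
    ∃ (H : (Fin q → ℝ) →L[ℝ] X) (S : ℝ≥0 → X →L[ℝ] X), Generates (closedLoop A C H) S ∧
      ∃ M γ : ℝ, 0 < M ∧ 0 < γ ∧
        (∀ t : ℝ≥0, 0 < t → ∀ v, ∃ v', ι v' = S t (ι v) ∧
          ‖v'‖ ≤ M * Real.exp (-γ * t) * ‖v‖) ∧
        ∀ t : ℝ≥0, 0 < t → ∀ x, ∃ v', ι v' = S t x ∧
          ‖v'‖ ^ 2 ≤ M * (1 + 1 / t) * Real.exp (-γ * t) * ‖x‖ ^ 2 := by
  obtain ⟨H, U, σ, γ, Θ, hγ, hσ, hσU, hU, hΘ, hgraph⟩ := hA.exists_feedback hfin hC hautus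
  refine ⟨H, _, generates_conj (fun k => (hσ k).trans_lt (by linarith)) Θ hgraph, ?_⟩
  have hΘ' : ∀ x, ∀ k ∉ U, ⟪b k, Θ.symm x⟫_ℝ = ⟪b k, x⟫_ℝ := fun x k hk => by
    rw [← hΘ (Θ.symm x) k hk, ContinuousLinearEquiv.apply_symm_apply]
  obtain ⟨c₁, hc₁, hlift₁⟩ := hA.exists_lift hE (Θ : X →L[ℝ] X) hΘ
  obtain ⟨c₂, hc₂, hlift₂⟩ := hA.exists_lift hE (Θ.symm : X →L[ℝ] X) hΘ'
  set N := ‖(Θ : X →L[ℝ] X)‖ with hN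
  have hdec : ∀ t : ℝ≥0, 0 < t → ∀ v, ∃ v', ι v' = Θ.symm (diag b (fun k => Real.exp (t * σ k))
      (Θ (ι v))) ∧ ‖v'‖ ≤ c₂ * (β / α) * c₁ * Real.exp (-γ * t) * ‖v‖ := by
    intro t ht v
    obtain ⟨v₁, h1, h1'⟩ := hlift₁ v
    obtain ⟨v₂, h2, h2'⟩ := hA.energy_decay hE hα hβ hc₀ hγ.le hσ hσU hU (NNReal.coe_pos.2 ht) v₁
    obtain ⟨v₃, h3, h3'⟩ := hlift₂ v₂
    refine ⟨v₃, by rw [h3, h2, h1]; rfl, h3'.trans ?_⟩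
    calc c₂ * ‖v₂‖ ≤ c₂ * (β / α * Real.exp (-γ * t) * (c₁ * ‖v‖)) := by
          gcongr
          refine h2'.trans ?_
          gcongr
      _ = _ := by ring
  have hsm : ∀ t : ℝ≥0, 0 < t → ∀ x, ∃ v', ι v' = Θ.symm (diag b (fun k => Real.exp (t * σ k))
      (Θ x)) ∧ ‖v'‖ ^ 2 ≤ (c₂ ^ 2 / α * (c₀ + 1) * N ^ 2) * (1 + 1 / t) * Real.exp (-γ * t) *
        ‖x‖ ^ 2 := by
    intro t ht x
    have ht' := NNReal.coe_pos.2 ht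
    obtain ⟨v₂, h2, h2'⟩ := hA.energy_smoothing hE hα hc₀ hγ.le hσ hσU hU ht' (Θ x)
    obtain ⟨v₃, h3, h3'⟩ := hlift₂ v₂
    refine ⟨v₃, by rw [h3, h2]; rfl, ?_⟩
    have h4 : ‖Θ x‖ ≤ N * ‖x‖ := (Θ : X →L[ℝ] X).le_opNorm x
    have h5 : c₀ + 1 / (t : ℝ) ≤ (c₀ + 1) * (1 + 1 / t) := by
      have : 0 < 1 / (t : ℝ) := by positivity
      nlinarith
    calc ‖v₃‖ ^ 2 ≤ (c₂ * ‖v₂‖) ^ 2 := by gcongr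
      _ = c₂ ^ 2 / α * (α * ‖v₂‖ ^ 2) := by field_simp
      _ ≤ c₂ ^ 2 / α * (((c₀ + 1) * (1 + 1 / t)) * Real.exp (-γ * t) * (N * ‖x‖) ^ 2) := by
          refine mul_le_mul_of_nonneg_left (h2'.trans ?_) (by positivity)
          gcongr
      _ = _ := by ring
  have hp1 : 0 ≤ c₂ * (β / α) * c₁ := by positivity
  have hp2 : 0 ≤ c₂ ^ 2 / α * (c₀ + 1) * N ^ 2 := by positivity
  refine ⟨c₂ * (β / α) * c₁ + c₂ ^ 2 / α * (c₀ + 1) * N ^ 2 + 1, γ, by positivity, hγ,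
    fun t ht v => ?_, fun t ht x => ?_⟩
  · obtain ⟨v', h1, h2⟩ := hdec t ht v
    refine ⟨v', h1, h2.trans ?_⟩
    gcongr
    linarith
  · obtain ⟨v', h1, h2⟩ := hsm t ht x
    refine ⟨v', h1, h2.trans ?_⟩
    gcongr
    linarith

end Energy

/-! ### Eigenvectors of the generator -/

section Eigenvector

variable {X : Type*} [NormedAddCommGroup X] [NormedSpace ℝ X]

/-- An eigenvector of the generator is an eigenvector of the semigroup. -/
lemma Generates.apply_eigenvector {B : X →ₗ.[ℝ] X} {S : ℝ≥0 → X →L[ℝ] X} (h : Generates B S)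
    {x : X} {μ : ℝ} (hx : (x, μ • x) ∈ B.graph) (t : ℝ≥0) : S t x = Real.exp (μ * t) • x := by
  have hlim := (h.2 x (μ • x)).1 hx
  -- The generator gives only right derivatives, and that of `e^{-μs} S(s) x` vanishes. A continuous
  -- function with zero right derivative is constant.
  let f : ℝ → X := fun s => Real.exp (-μ * s) • S s.toNNReal x
  have hcont : Continuous f :=
    (by fun_prop : Continuous fun s : ℝ => Real.exp (-μ * s)).smul
      ((h.1.continuous x).comp continuous_real_toNNReal)
  have hderiv : ∀ s ∈ Set.Ico (0 : ℝ) t, HasDerivWithinAt f 0 (Set.Ici s) s := by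
    intro s hs
    have hS : HasDerivWithinAt (fun s : ℝ => S s.toNNReal x) (μ • S s.toNNReal x) (Set.Ici s) s := by
      rw [← hasDerivWithinAt_Ioi_iff_Ici,
        hasDerivWithinAt_iff_tendsto_slope' (Set.notMem_Ioi.2 le_rfl)]
      have hsub : Tendsto (fun r : ℝ => (r - s).toNNReal) (𝓝[>] s) (𝓝[>] 0) := by
        refine tendsto_nhdsWithin_iff.2 ⟨?_, ?_⟩
        · refine Tendsto.mono_left ?_ nhdsWithin_le_nhds
          exact (by fun_prop : Continuous fun r : ℝ => (r - s).toNNReal).tendsto' s 0 (by simp)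
        · filter_upwards [self_mem_nhdsWithin] with r hr
          exact Real.toNNReal_pos.2 (sub_pos.2 hr)
      have h1 := ((S s.toNNReal).continuous.tendsto _).comp (hlim.comp hsub)
      rw [map_smul] at h1
      refine h1.congr' ?_
      filter_upwards [self_mem_nhdsWithin] with r hr
      have hr' : s < r := hr
      have e : r.toNNReal = s.toNNReal + (r - s).toNNReal := by
        rw [← Real.toNNReal_add hs.1 (by linarith), add_sub_cancel]
      simp only [Function.comp_apply, slope, vsub_eq_sub]
      rw [e, h.1.map_add, map_smul, map_sub, Real.coe_toNNReal _ (by linarith)]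
      rfl
    have hexp : HasDerivWithinAt (fun s : ℝ => Real.exp (-μ * s)) (Real.exp (-μ * s) * -μ)
        (Set.Ici s) s := by
      simpa using (((hasDerivAt_id s).const_mul (-μ)).exp).hasDerivWithinAt
    have := hexp.smul hS
    refine this.congr_deriv ?_
    rw [mul_smul, ← smul_add]
    simp
  have hconst := constant_of_has_deriv_right_zero hcont.continuousOn hderiv t ⟨t.2, le_rfl⟩
  simp only [f, mul_zero, Real.exp_zero, one_smul, Real.toNNReal_zero, h.1.map_zero,
    ContinuousLinearMap.id_apply, Real.toNNReal_coe] at hconst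
  calc S t x = (Real.exp (μ * t) * Real.exp (-μ * t)) • S t x := by
        rw [← Real.exp_add]
        simp
    _ = Real.exp (μ * t) • x := by rw [mul_smul, hconst]

end Eigenvector

/-! ### Approximation of Sobolev functions by averages on cubes -/

section Averages

variable {n : ℕ}

lemma sq_lintegral_le {S : Type*} [MeasurableSpace S] (μ : Measure S) {f : S → ENNReal}
    (hf : AEMeasurable f μ) : (∫⁻ s, f s ∂μ) ^ 2 ≤ μ Set.univ * ∫⁻ s, f s ^ 2 ∂μ := by
  have h := ENNReal.lintegral_mul_le_Lp_mul_Lq μ Real.HolderConjugate.two_two hf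
    (aemeasurable_const (b := (1 : ENNReal)))
  simp only [Pi.mul_apply, mul_one, lintegral_const, one_mul, one_pow,
    ENNReal.rpow_ofNat] at h
  calc (∫⁻ s, f s ∂μ) ^ 2
      ≤ ((∫⁻ s, f s ^ 2 ∂μ) ^ (1 / 2 : ℝ) * μ Set.univ ^ (1 / 2 : ℝ)) ^ 2 := by gcongr
    _ = μ Set.univ * ∫⁻ s, f s ^ 2 ∂μ := by
      rw [mul_pow, ← ENNReal.rpow_natCast, ← ENNReal.rpow_natCast, ← ENNReal.rpow_mul,
        ← ENNReal.rpow_mul]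
      norm_num
      rw [mul_comm]

/-- The fundamental theorem of calculus along the segment from `ξ` to `ξ + z`, then Cauchy–Schwarz
in the parameter, Tonelli and translation invariance. -/
lemma lintegral_sub_translate_le {u : E n → ℝ} (hu : ContDiff ℝ 1 u) (z : E n) :
    ∫⁻ ξ, ‖u ξ - u (ξ + z)‖ₑ ^ 2 ≤ ‖z‖ₑ ^ 2 * ∫⁻ ξ, ‖fderiv ℝ u ξ‖ₑ ^ 2 := by
  have hc : Continuous (fderiv ℝ u) := hu.continuous_fderiv (by simp)
  have hpt : ∀ ξ, ‖u ξ - u (ξ + z)‖ₑ ^ 2 ≤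
      ∫⁻ t in Set.Ioc (0 : ℝ) 1, ‖z‖ₑ ^ 2 * ‖fderiv ℝ u (ξ + t • z)‖ₑ ^ 2 := by
    intro ξ
    have hd : ∀ t : ℝ, HasDerivAt (fun t : ℝ => u (ξ + t • z)) (fderiv ℝ u (ξ + t • z) z) t := by
      intro t
      have h1 : HasDerivAt (fun t : ℝ => ξ + t • z) z t := by
        simpa using ((hasDerivAt_id t).smul_const z).const_add ξ
      exact ((hu.differentiable (by simp)) _).hasFDerivAt.comp_hasDerivAt t h1
    have hct : Continuous fun t : ℝ => fderiv ℝ u (ξ + t • z) z :=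
      (hc.comp (by fun_prop)).clm_apply continuous_const
    have hint := intervalIntegral.integral_eq_sub_of_hasDerivAt (a := 0) (b := 1)
      (fun t _ => hd t) (hct.intervalIntegrable 0 1)
    rw [intervalIntegral.integral_of_le zero_le_one, one_smul, zero_smul, add_zero] at hint
    rw [← enorm_neg, neg_sub, ← hint]
    have hprob : (volume.restrict (Set.Ioc (0 : ℝ) 1)) Set.univ = 1 := by simp
    calc ‖∫ t in Set.Ioc (0 : ℝ) 1, fderiv ℝ u (ξ + t • z) z‖ₑ ^ 2
        ≤ (∫⁻ t in Set.Ioc (0 : ℝ) 1, ‖fderiv ℝ u (ξ + t • z) z‖ₑ) ^ 2 := by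
          gcongr
          exact enorm_integral_le_lintegral_enorm _
      _ ≤ ∫⁻ t in Set.Ioc (0 : ℝ) 1, ‖fderiv ℝ u (ξ + t • z) z‖ₑ ^ 2 := by
          refine (sq_lintegral_le _ hct.enorm.aemeasurable).trans ?_
          rw [hprob, one_mul]
      _ ≤ ∫⁻ t in Set.Ioc (0 : ℝ) 1, ‖z‖ₑ ^ 2 * ‖fderiv ℝ u (ξ + t • z)‖ₑ ^ 2 := by
          refine lintegral_mono fun t => ?_
          rw [mul_comm, ← mul_pow]
          gcongr
          exact ContinuousLinearMap.le_opENorm _ _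
  refine (lintegral_mono hpt).trans ?_
  rw [lintegral_lintegral_swap]
  · calc _ = ∫⁻ t in Set.Ioc (0 : ℝ) 1, ‖z‖ₑ ^ 2 * ∫⁻ ξ, ‖fderiv ℝ u ξ‖ₑ ^ 2 := by
          refine lintegral_congr fun t => ?_
          rw [lintegral_const_mul' _ _ (by simp)]
          congr 1
          exact lintegral_add_right_eq_self (fun ξ => ‖fderiv ℝ u ξ‖ₑ ^ 2) (t • z)
      _ ≤ _ := by simp
  · refine Measurable.aemeasurable ?_
    have : Continuous fun p : E n × ℝ => fderiv ℝ u (p.1 + p.2 • z) := hc.comp (by fun_prop)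
    exact measurable_const.mul (this.enorm.measurable.pow_const 2)

/-- The index of the cube of side `h` containing `ξ`. -/
def cellIndex (h : ℝ) (ξ : E n) (i : Fin n) : ℤ := ⌊ξ i / h⌋

/-- The half-open cube of side `h` and index `m`. -/
def cube (h : ℝ) (m : Fin n → ℤ) : Set (E n) := {ξ | cellIndex h ξ = m}

variable {h : ℝ}

lemma cube_eq_preimage (hh : 0 < h) (m : Fin n → ℤ) :
    cube h m = (MeasurableEquiv.toLp 2 (Fin n → ℝ)).symm ⁻¹'
      (Set.univ.pi fun i => Set.Ico (m i * h) ((m i + 1) * h)) := by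
  ext ξ
  simp only [cube, cellIndex, Set.mem_ofPred_eq, funext_iff, Int.floor_eq_iff, Set.mem_preimage,
    Set.mem_pi, Set.mem_univ, true_implies, Set.mem_Ico, le_div_iff₀ hh, div_lt_iff₀ hh]
  rfl

lemma measurableSet_cube (hh : 0 < h) (m : Fin n → ℤ) : MeasurableSet (cube h m) := by
  rw [cube_eq_preimage hh]
  exact (MeasurableEquiv.measurable _) (MeasurableSet.univ_pi fun i => measurableSet_Ico)

lemma volume_cube (hh : 0 < h) (m : Fin n → ℤ) : volume (cube h m) = ENNReal.ofReal (h ^ n) := by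
  rw [cube_eq_preimage hh, (EuclideanSpace.volume_preserving_symm_measurableEquiv_toLp
    (Fin n)).measure_preimage_equiv, Real.volume_pi_Ico]
  have : ∀ i, ((m i : ℝ) + 1) * h - m i * h = h := fun i => by ring
  simp only [this, Finset.prod_const, Finset.card_univ, Fintype.card_fin]
  rw [ENNReal.ofReal_pow hh.le]

/-- The closed cube of side `2 h` centred at `0`. -/
def box (n : ℕ) (h : ℝ) : Set (E n) := {z | ∀ i, |z i| ≤ h}

lemma box_eq_preimage (h : ℝ) :
    box n h = (MeasurableEquiv.toLp 2 (Fin n → ℝ)).symm ⁻¹'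
      (Set.Icc (fun _ => -h) fun _ => h) := by
  ext ξ
  simp only [box, Set.mem_ofPred_eq, abs_le, Set.mem_preimage, Set.mem_Icc, Pi.le_def,
    forall_and]
  rfl

lemma measurableSet_box (h : ℝ) : MeasurableSet (box n h) := by
  rw [box_eq_preimage]
  exact (MeasurableEquiv.measurable _) measurableSet_Icc

lemma volume_box (hh : 0 < h) : volume (box n h) = ENNReal.ofReal ((2 * h) ^ n) := by
  rw [box_eq_preimage, (EuclideanSpace.volume_preserving_symm_measurableEquiv_toLp
    (Fin n)).measure_preimage_equiv, Real.volume_Icc_pi]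
  simp only [sub_neg_eq_add, ← two_mul, Finset.prod_const, Finset.card_univ, Fintype.card_fin]
  rw [ENNReal.ofReal_pow (by positivity)]

lemma enorm_sq_le_of_mem_box {z : E n} (hz : z ∈ box n h) :
    ‖z‖ₑ ^ 2 ≤ ENNReal.ofReal (n * h ^ 2) := by
  rw [← ofReal_norm, ← ENNReal.ofReal_pow (norm_nonneg _)]
  refine ENNReal.ofReal_le_ofReal ?_
  rw [EuclideanSpace.norm_sq_eq]
  calc ∑ i, ‖z i‖ ^ 2 ≤ ∑ _i : Fin n, h ^ 2 :=
        Finset.sum_le_sum fun i _ => pow_le_pow_left₀ (norm_nonneg _) (hz i) 2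
    _ = n * h ^ 2 := by simp

lemma sub_mem_box_of_mem_cube (hh : 0 < h) {m : Fin n → ℤ} {ξ η : E n} (hξ : ξ ∈ cube h m)
    (hη : η ∈ cube h m) : η - ξ ∈ box n h := by
  rw [cube_eq_preimage hh] at hξ hη
  intro i
  have h1 : (m i : ℝ) * h ≤ ξ i ∧ ξ i < (m i + 1) * h := hξ i trivial
  have h2 : (m i : ℝ) * h ≤ η i ∧ η i < (m i + 1) * h := hη i trivial
  rw [PiLp.sub_apply, abs_le]
  constructor <;> nlinarith

/-- Poincaré inequality for the averages on the cubes of a grid. -/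
theorem lintegral_sub_average_le {u : E n → ℝ} (hu : ContDiff ℝ 1 u) (hs : HasCompactSupport u)
    (hh : 0 < h) :
    ∫⁻ ξ, ‖u ξ - (h ^ n)⁻¹ * ∫ η in cube h (cellIndex h ξ), u η‖ₑ ^ 2 ≤
      ENNReal.ofReal (2 ^ n * n * h ^ 2) * ∫⁻ ξ, ‖fderiv ℝ u ξ‖ₑ ^ 2 := by
  have hint : Integrable u := hu.continuous.integrable_of_hasCompactSupport hs
  have hV : ENNReal.ofReal (h ^ n) ≠ 0 := by
    rw [Ne, ENNReal.ofReal_eq_zero, not_le]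
    positivity
  have hVtop : ENNReal.ofReal (h ^ n) ≠ ⊤ := ENNReal.ofReal_ne_top
  -- The deviation from the average is the average of `u ξ - u η` over the cube. That cube lies in
  -- `ξ + box n h`; passing to the box removes the dependence on the cell and leaves translates to
  -- be integrated.
  have hpt : ∀ ξ, ‖u ξ - (h ^ n)⁻¹ * ∫ η in cube h (cellIndex h ξ), u η‖ₑ ^ 2 ≤
      (ENNReal.ofReal (h ^ n))⁻¹ * ∫⁻ z in box n h, ‖u ξ - u (ξ + z)‖ₑ ^ 2 := by
    intro ξ
    set Q := cube h (cellIndex h ξ) with hQ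
    have hQm : MeasurableSet Q := measurableSet_cube hh _
    have hQv : volume Q = ENNReal.ofReal (h ^ n) := volume_cube hh _
    have hreal : volume.real Q = h ^ n := by
      rw [measureReal_def, hQv, ENNReal.toReal_ofReal (by positivity)]
    have hconst : IntegrableOn (fun _ => u ξ) Q :=
      integrableOn_const (hs := by rw [hQv]; exact hVtop)
    have e : u ξ - (h ^ n)⁻¹ * ∫ η in Q, u η = (h ^ n)⁻¹ * ∫ η in Q, (u ξ - u η) := by
      rw [integral_sub hconst hint.integrableOn,
        setIntegral_const, hreal, smul_eq_mul]
      have : h ^ n ≠ 0 := by positivity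
      field_simp
    have hme : Measurable fun η => ‖u ξ - u η‖ₑ :=
      (continuous_const.sub hu.continuous).enorm.measurable
    have hshift : ∫⁻ η in Q, ‖u ξ - u η‖ₑ ^ 2 ≤ ∫⁻ z in box n h, ‖u ξ - u (ξ + z)‖ₑ ^ 2 := by
      rw [← lintegral_indicator hQm, ← lintegral_indicator (measurableSet_box h),
        ← lintegral_add_left_eq_self _ ξ]
      refine lintegral_mono fun z => ?_
      by_cases hz : ξ + z ∈ Q
      · have hb : z ∈ box n h := by
          have := sub_mem_box_of_mem_cube hh (show ξ ∈ Q from rfl) hz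
          rwa [add_sub_cancel_left] at this
        rw [Set.indicator_of_mem hz, Set.indicator_of_mem hb]
      · rw [Set.indicator_of_notMem hz]
        exact zero_le
    have hinv : ‖(h ^ n)⁻¹‖ₑ = (ENNReal.ofReal (h ^ n))⁻¹ := by
      rw [Real.enorm_of_nonneg (by positivity), ENNReal.ofReal_inv_of_pos (by positivity)]
    rw [e, enorm_mul, mul_pow, hinv]
    calc (ENNReal.ofReal (h ^ n))⁻¹ ^ 2 * ‖∫ η in Q, (u ξ - u η)‖ₑ ^ 2
        ≤ (ENNReal.ofReal (h ^ n))⁻¹ ^ 2 * (∫⁻ η in Q, ‖u ξ - u η‖ₑ) ^ 2 := by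
          gcongr
          exact enorm_integral_le_lintegral_enorm _
      _ ≤ (ENNReal.ofReal (h ^ n))⁻¹ ^ 2 *
          (ENNReal.ofReal (h ^ n) * ∫⁻ η in Q, ‖u ξ - u η‖ₑ ^ 2) := by
          gcongr
          refine (sq_lintegral_le _ hme.aemeasurable).trans ?_
          rw [Measure.restrict_apply_univ, hQv]
      _ = (ENNReal.ofReal (h ^ n))⁻¹ * ∫⁻ η in Q, ‖u ξ - u η‖ₑ ^ 2 := by
          rw [sq, mul_assoc, ← mul_assoc _ (ENNReal.ofReal (h ^ n)),
            ENNReal.inv_mul_cancel hV hVtop, one_mul]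
      _ ≤ _ := by gcongr
  refine (lintegral_mono hpt).trans ?_
  rw [lintegral_const_mul' _ _ (ENNReal.inv_ne_top.2 hV), lintegral_lintegral_swap]
  · calc (ENNReal.ofReal (h ^ n))⁻¹ * ∫⁻ z in box n h, ∫⁻ ξ, ‖u ξ - u (ξ + z)‖ₑ ^ 2
        ≤ (ENNReal.ofReal (h ^ n))⁻¹ * ∫⁻ _z in box n h,
          ENNReal.ofReal (n * h ^ 2) * ∫⁻ ξ, ‖fderiv ℝ u ξ‖ₑ ^ 2 := by
          refine mul_le_mul' le_rfl ?_
          refine setLIntegral_mono' (measurableSet_box h) fun z hz => ?_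
          refine (lintegral_sub_translate_le hu z).trans ?_
          gcongr
          exact enorm_sq_le_of_mem_box hz
      -- The factor `2 ^ n` is the ratio of the volumes of box and cube, and `n * h ^ 2` bounds
      -- `‖z‖²` on the box.
      _ = ENNReal.ofReal (2 ^ n * n * h ^ 2) * ∫⁻ ξ, ‖fderiv ℝ u ξ‖ₑ ^ 2 := by
          rw [setLIntegral_const, volume_box hh, ← ENNReal.ofReal_inv_of_pos (by positivity),
            mul_comm (_ * _) (ENNReal.ofReal ((2 * h) ^ n)), ← mul_assoc, ← mul_assoc,
            ← ENNReal.ofReal_mul (by positivity), ← ENNReal.ofReal_mul (by positivity)]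
          congr 2
          rw [mul_pow]
          field_simp
  · refine Continuous.measurable ?_ |>.pow_const 2 |>.aemeasurable
    have := hu.continuous
    exact Continuous.enorm (by fun_prop)

end Averages

/-! ### The Rellich theorem for `H¹₀(Ω)` -/

section Rellich

variable {n : ℕ} {Ω : Set (E n)}

lemma enorm_sq_eq_lintegral {S F : Type*} [MeasurableSpace S] [NormedAddCommGroup F]
    {μ : Measure S} (f : Lp F 2 μ) : ‖f‖ₑ ^ 2 = ∫⁻ s, ‖f s‖ₑ ^ 2 ∂μ := by
  rw [Lp.enorm_def, eLpNorm_eq_lintegral_rpow_enorm_toReal (by norm_num) (by norm_num),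
    ← ENNReal.rpow_natCast, ← ENNReal.rpow_mul]
  norm_num

/-- The energy space: `H¹₀(Ω)` with its Hilbert space structure, as a space of pairs `(u, ∇u)`. -/
def energySpace (Ω : Set (E n)) : Submodule ℝ (WithLp 2 (L2 Ω × L2Vec Ω)) :=
  (h10Graph Ω).comap (WithLp.linearEquiv 2 ℝ (L2 Ω × L2Vec Ω)).toLinearMap

instance (Ω : Set (E n)) : CompleteSpace (energySpace Ω) := by
  have : IsClosed (energySpace Ω : Set (WithLp 2 (L2 Ω × L2Vec Ω))) :=
    (testGraph Ω).isClosed_topologicalClosure.preimage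
      (WithLp.prodContinuousLinearEquiv 2 ℝ (L2 Ω) (L2Vec Ω)).continuous
  exact this.completeSpace_coe

/-- The embedding of `H¹₀(Ω)` into `L²(Ω)`. -/
def energyFst (Ω : Set (E n)) : energySpace Ω →L[ℝ] L2 Ω :=
  (WithLp.fstL 2 ℝ (L2 Ω) (L2Vec Ω)).comp (energySpace Ω).subtypeL

/-- The gradient as a bounded operator on `H¹₀(Ω)`. -/
def energyGrad (Ω : Set (E n)) : energySpace Ω →L[ℝ] L2Vec Ω :=
  (WithLp.sndL 2 ℝ (L2 Ω) (L2Vec Ω)).comp (energySpace Ω).subtypeL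

lemma energySpace_mem (v : energySpace Ω) : (energyFst Ω v, energyGrad Ω v) ∈ h10Graph Ω := v.2

lemma exists_energySpace {p : L2 Ω × L2Vec Ω} (hp : p ∈ h10Graph Ω) :
    ∃ v : energySpace Ω, energyFst Ω v = p.1 ∧ energyGrad Ω v = p.2 :=
  ⟨⟨WithLp.toLp 2 p, hp⟩, rfl, rfl⟩

lemma energySpace_norm_sq (v : energySpace Ω) :
    ‖v‖ ^ 2 = ‖energyFst Ω v‖ ^ 2 + ‖energyGrad Ω v‖ ^ 2 :=
  WithLp.prod_norm_sq_eq_of_L2 (v : WithLp 2 (L2 Ω × L2Vec Ω))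

variable {h : ℝ}

lemma finite_cells (hΩ : Bornology.IsBounded Ω) (hh : 0 < h) :
    (cellIndex h '' Ω : Set (Fin n → ℤ)).Finite := by
  obtain ⟨R, hR⟩ := hΩ.exists_norm_le
  refine (Set.Finite.pi' (t := fun _ : Fin n => Set.Icc ⌊-R / h⌋ ⌊R / h⌋)
    fun _ => Set.finite_Icc _ _).subset ?_
  rintro _ ⟨ξ, hξ, rfl⟩ i
  have h1 := abs_le.1 ((PiLp.norm_apply_le ξ i).trans (hR ξ hξ))
  exact ⟨Int.floor_le_floor (by gcongr; exact h1.1), Int.floor_le_floor (by gcongr; exact h1.2)⟩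

/-- The indicator function of a grid cube, in `L²(Ω)`. -/
def cubeIndicator (Ω : Set (E n)) (hh : 0 < h) (m : Fin n → ℤ) : L2 Ω :=
  indicatorConstLp 2 (measurableSet_cube hh m)
    ((Measure.restrict_apply_le _ _).trans_lt (by
      rw [volume_cube hh]
      exact ENNReal.ofReal_lt_top)).ne (1 : ℝ)

/-- The operator which averages a function over the cubes of the grid of side `h`. -/
def averageOp (hΩ : Bornology.IsBounded Ω) (hh : 0 < h) : L2 Ω →L[ℝ] L2 Ω :=
  ∑ m ∈ (finite_cells hΩ hh).toFinset, (h ^ n)⁻¹ •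
    (innerSL ℝ (cubeIndicator Ω hh m)).smulRight (cubeIndicator Ω hh m)

lemma isCompactOperator_averageOp (hΩ : Bornology.IsBounded Ω) (hh : 0 < h) :
    IsCompactOperator (averageOp hΩ hh) := by
  have : averageOp hΩ hh ∈ compactOperator (RingHom.id ℝ) (L2 Ω) (L2 Ω) := by
    refine Submodule.sum_mem _ fun m _ => Submodule.smul_mem _ _ ?_
    have h1 : IsCompactOperator (innerSL ℝ (cubeIndicator Ω hh m)) :=
      isCompactOperator_of_locallyCompactSpace_dom _
    exact h1.clm_comp (ContinuousLinearMap.toSpanSingleton ℝ (cubeIndicator Ω hh m))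
  exact this

/-- As `u` vanishes outside `Ω`, the inner product in `L²(Ω)` with the indicator is the integral
over the whole cube, also for cubes that cross the boundary. -/
lemma averageOp_ae (hΩm : MeasurableSet Ω) (hΩ : Bornology.IsBounded Ω) (hh : 0 < h) {x : L2 Ω}
    {u : E n → ℝ} (hxu : (x : E n → ℝ) =ᵐ[volume.restrict Ω] u) (hu : ∀ ξ ∉ Ω, u ξ = 0) :
    ∀ᵐ ξ ∂(volume.restrict Ω), averageOp hΩ hh x ξ =
      (h ^ n)⁻¹ * ∫ η in cube h (cellIndex h ξ), u η := by
  have hcoef : ∀ m, ⟪cubeIndicator Ω hh m, x⟫_ℝ = ∫ η in cube h m, u η := by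
    intro m
    rw [cubeIndicator, L2.inner_indicatorConstLp_one, Measure.restrict_restrict
      (measurableSet_cube hh m), ← setIntegral_indicator hΩm]
    have h1 : ∀ᵐ η, η ∈ Ω → x η = u η := (ae_restrict_iff' hΩm).1 hxu
    refine integral_congr_ae (ae_restrict_of_ae ?_)
    filter_upwards [h1] with η hη
    by_cases hm : η ∈ Ω
    · rw [Set.indicator_of_mem hm, hη hm]
    · rw [Set.indicator_of_notMem hm, hu η hm]
  have hsum : averageOp hΩ hh x = ∑ m ∈ (finite_cells hΩ hh).toFinset,
      ((h ^ n)⁻¹ * ∫ η in cube h m, u η) • cubeIndicator Ω hh m := by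
    simp only [averageOp, _root_.sum_apply, _root_.smul_apply,
      ContinuousLinearMap.smulRight_apply, innerSL_apply_apply, hcoef, smul_smul]
  have h2 : ∀ m : Fin n → ℤ, ∀ᵐ ξ ∂(volume.restrict Ω),
      (((h ^ n)⁻¹ * ∫ η in cube h m, u η) • cubeIndicator Ω hh m : L2 Ω) ξ =
      ((h ^ n)⁻¹ * ∫ η in cube h m, u η) * (cube h m).indicator (fun _ => (1 : ℝ)) ξ := by
    intro m
    filter_upwards [Lp.coeFn_smul ((h ^ n)⁻¹ * ∫ η in cube h m, u η) (cubeIndicator Ω hh m),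
      indicatorConstLp_coeFn (p := 2) (μ := volume.restrict Ω) (hs := measurableSet_cube hh m)
      (hμs := ((Measure.restrict_apply_le _ _).trans_lt (by
      rw [volume_cube hh]
      exact ENNReal.ofReal_lt_top)).ne) (c := (1 : ℝ))] with ξ e1 e2
    rw [e1, Pi.smul_apply, smul_eq_mul]
    congr 1
  rw [hsum]
  filter_upwards [Lp.coeFn_finsetSum (finite_cells hΩ hh).toFinset
    fun m => ((h ^ n)⁻¹ * ∫ η in cube h m, u η) • cubeIndicator Ω hh m, ae_all_iff.2 h2,
    ae_restrict_mem hΩm] with ξ e1 e2 hξ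
  rw [e1, Finset.sum_apply, Finset.sum_congr rfl fun m _ => e2 m,
    Finset.sum_eq_single (cellIndex h ξ)]
  · rw [Set.indicator_of_mem (show ξ ∈ cube h (cellIndex h ξ) from rfl), mul_one]
  · intro m _ hm
    rw [Set.indicator_of_notMem (fun hmem : ξ ∈ cube h m => hm (Eq.symm hmem)), mul_zero]
  · intro hnot
    exact absurd ((finite_cells hΩ hh).mem_toFinset.2 ⟨ξ, hξ, rfl⟩) hnot

/-- The inequality is closed in the graph norm, so it suffices to have it for test functions, where
the Poincaré inequality on cubes applies after extension by zero. -/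
lemma norm_sub_averageOp_le (hΩm : MeasurableSet Ω) (hΩ : Bornology.IsBounded Ω) (hh : 0 < h)
    {p : L2 Ω × L2Vec Ω} (hp : p ∈ h10Graph Ω) :
    ‖p.1 - averageOp hΩ hh p.1‖ ≤ Real.sqrt (2 ^ n * n) * h * ‖p.2‖ := by
  have hclosed : IsClosed {p : L2 Ω × L2Vec Ω |
      ‖p.1 - averageOp hΩ hh p.1‖ ≤ Real.sqrt (2 ^ n * n) * h * ‖p.2‖} :=
    isClosed_le (by fun_prop) (by fun_prop)
  refine closure_minimal (s := (testGraph Ω : Set (L2 Ω × L2Vec Ω))) ?_ hclosed hp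
  rintro p ⟨φ, hφ, h1, h2⟩
  have hzero : ∀ ξ ∉ Ω, φ ξ = 0 := fun ξ hξ => by
    by_contra hne
    exact hξ (hφ.2.2 (subset_tsupport _ hne))
  have hgzero : ∀ ξ ∉ Ω, gradient φ ξ = 0 := fun ξ hξ => by
    have : fderiv ℝ φ ξ = 0 := by
      by_contra hne
      exact hξ (hφ.2.2 (tsupport_fderiv_subset ℝ (subset_tsupport _ hne)))
    simp [gradient, this]
  have key : ‖p.1 - averageOp hΩ hh p.1‖ₑ ^ 2 ≤
      ENNReal.ofReal (2 ^ n * n * h ^ 2) * ‖p.2‖ₑ ^ 2 := by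
    rw [enorm_sq_eq_lintegral, enorm_sq_eq_lintegral]
    calc ∫⁻ ξ in Ω, ‖(p.1 - averageOp hΩ hh p.1 : L2 Ω) ξ‖ₑ ^ 2
        = ∫⁻ ξ in Ω, ‖φ ξ - (h ^ n)⁻¹ * ∫ η in cube h (cellIndex h ξ), φ η‖ₑ ^ 2 := by
          refine lintegral_congr_ae ?_
          filter_upwards [Lp.coeFn_sub p.1 (averageOp hΩ hh p.1), h1,
            averageOp_ae hΩm hΩ hh h1 hzero] with ξ e1 e2 e3
          rw [e1, Pi.sub_apply, e2, e3]
      _ ≤ ∫⁻ ξ, ‖φ ξ - (h ^ n)⁻¹ * ∫ η in cube h (cellIndex h ξ), φ η‖ₑ ^ 2 :=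
          setLIntegral_le_lintegral _ _
      _ ≤ ENNReal.ofReal (2 ^ n * n * h ^ 2) * ∫⁻ ξ, ‖fderiv ℝ φ ξ‖ₑ ^ 2 :=
          lintegral_sub_average_le (hφ.1.of_le (by simp)) hφ.2.1 hh
      _ = ENNReal.ofReal (2 ^ n * n * h ^ 2) * ∫⁻ ξ in Ω, ‖p.2 ξ‖ₑ ^ 2 := by
          congr 1
          have e : ∀ ξ, ‖fderiv ℝ φ ξ‖ₑ = ‖gradient φ ξ‖ₑ := fun ξ => by
            rw [← ofReal_norm, ← ofReal_norm, gradient, LinearIsometryEquiv.norm_map]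
          simp only [e]
          have e' : ∫⁻ ξ in Ω, ‖p.2 ξ‖ₑ ^ 2 = ∫⁻ ξ in Ω, ‖gradient φ ξ‖ₑ ^ 2 := by
            refine lintegral_congr_ae ?_
            filter_upwards [h2] with ξ e2
            rw [e2]
          rw [e', ← lintegral_indicator hΩm]
          refine lintegral_congr fun ξ => ?_
          by_cases hξ : ξ ∈ Ω
          · rw [Set.indicator_of_mem hξ]
          · rw [Set.indicator_of_notMem hξ, hgzero ξ hξ]
            simp
  have hpos : (0 : ℝ) ≤ 2 ^ n * n * h ^ 2 := by positivity
  rw [← ofReal_norm, ← ofReal_norm, ← ENNReal.ofReal_pow (norm_nonneg _),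
    ← ENNReal.ofReal_pow (norm_nonneg _), ← ENNReal.ofReal_mul hpos,
    ENNReal.ofReal_le_ofReal_iff (by positivity)] at key
  change ‖p.1 - averageOp hΩ hh p.1‖ ≤ Real.sqrt (2 ^ n * n) * h * ‖p.2‖
  refine le_of_sq_le_sq ?_ (by positivity)
  rwa [mul_pow, mul_pow, Real.sq_sqrt (by positivity)]

/-- The Rellich theorem: the embedding of `H¹₀(Ω)` into `L²(Ω)` is compact for bounded `Ω`. -/
theorem isCompactOperator_energyFst (hΩm : MeasurableSet Ω) (hΩ : Bornology.IsBounded Ω) :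
    IsCompactOperator (energyFst Ω) := by
  have hpos : ∀ k : ℕ, (0 : ℝ) < 1 / ((k : ℝ) + 1) := fun k => Nat.one_div_pos_of_nat
  -- The embedding is the norm limit of the finite rank averages as the mesh `1 / (k + 1)` tends to
  -- zero.
  refine isCompactOperator_of_tendsto (l := atTop)
    (F := fun k : ℕ => (averageOp hΩ (hpos k)).comp (energyFst Ω)) ?_
    (Eventually.of_forall fun k => (isCompactOperator_averageOp hΩ (hpos k)).comp_clm _)
  refine (tendsto_iff_norm_sub_tendsto_zero (E := energySpace Ω →L[ℝ] L2 Ω)).2 ?_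
  have hlim : Tendsto (fun k : ℕ => Real.sqrt (2 ^ n * n) * (1 / ((k : ℝ) + 1))) atTop (𝓝 0) := by
    simpa using tendsto_one_div_add_atTop_nhds_zero_nat.const_mul (Real.sqrt (2 ^ n * n))
  refine squeeze_zero (fun k => ContinuousLinearMap.opNorm_nonneg _) (fun k => ?_) hlim
  refine ContinuousLinearMap.opNorm_le_bound _ (by have := hpos k; positivity) fun v => ?_
  refine (norm_sub_rev _ _).trans_le ?_
  refine (norm_sub_averageOp_le hΩm hΩ (hpos k) (energySpace_mem v)).trans ?_
  have : ‖energyGrad Ω v‖ ≤ ‖v‖ := by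
    refine le_of_sq_le_sq ?_ (norm_nonneg _)
    rw [energySpace_norm_sq v]
    linarith [sq_nonneg ‖energyFst Ω v‖]
  have := hpos k
  gcongr

end Rellich

/-! ### Operators associated with coercive forms -/

section Form

universe u

variable {X : Type u} {V : Type*} [NormedAddCommGroup X] [InnerProductSpace ℝ X] [CompleteSpace X]
  [NormedAddCommGroup V] [InnerProductSpace ℝ V] [CompleteSpace V]

/-- The operator of a symmetric coercive form on a compactly embedded Hilbert space is diagonal,
with eigenvalues tending to `-∞`. -/
theorem exists_isDiagonal_of_form {A : X →ₗ.[ℝ] X} {ι : V →L[ℝ] X} (hι : IsCompactOperator ι)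
    {T : V →L[ℝ] V} (hT : ∀ v w, ⟪T v, w⟫_ℝ = ⟪T w, v⟫_ℝ) {c₀ α : ℝ} (hα : 0 < α)
    (hcoer : ∀ v, α * ‖v‖ ^ 2 ≤ ⟪T v, v⟫_ℝ)
    (hA : ∀ x z, (x, z) ∈ A.graph ↔ ∃ v, ι v = x ∧ ∀ w, ⟪T v, w⟫_ℝ = ⟪c₀ • x - z, ι w⟫_ℝ) :
    ∃ (K : Type u) (b : HilbertBasis K ℝ X) (lam : K → ℝ), IsDiagonal A b lam ∧
      (∀ N, {k | N ≤ lam k}.Finite) ∧ HasEnergy A ι c₀ α ‖T‖ := by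
  let B : V →L[ℝ] V →L[ℝ] ℝ :=
    (isBoundedBilinearMap_inner (𝕜 := ℝ) (E := V)).toContinuousLinearMap.comp T
  have hB : ∀ v w, B v w = ⟪T v, w⟫_ℝ := fun v w => rfl
  have hBc : IsCoercive B := ⟨α, hα, fun v => by rw [hB, mul_assoc, ← sq]; exact hcoer v⟩
  let Λ := hBc.continuousLinearEquivOfBilin
  have hΛ : ∀ v w, ⟪Λ v, w⟫_ℝ = ⟪T v, w⟫_ℝ := fun v w =>
    hBc.continuousLinearEquivOfBilin_apply v w
  -- Lax–Milgram: `G f` solves `⟪T v, w⟫ = ⟪f, ι w⟫` for all `w`, so `R = ι G` is the inverse of `c₀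
  -- - A`, compact and symmetric.
  let G : X →L[ℝ] V := (Λ.symm : V →L[ℝ] V).comp (ContinuousLinearMap.adjoint ι)
  have hG : ∀ f w, ⟪T (G f), w⟫_ℝ = ⟪f, ι w⟫_ℝ := fun f w => by
    rw [← hΛ]
    change ⟪Λ (Λ.symm (ContinuousLinearMap.adjoint ι f)), w⟫_ℝ = _
    rw [ContinuousLinearEquiv.apply_symm_apply, ContinuousLinearMap.adjoint_inner_left]
  have hGuniq : ∀ f v, (∀ w, ⟪T v, w⟫_ℝ = ⟪f, ι w⟫_ℝ) → v = G f := fun f v hv => by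
    refine Λ.injective (ext_inner_right ℝ fun w => ?_)
    rw [hΛ, hΛ, hG, hv]
  let R : X →L[ℝ] X := ι.comp G
  have hR : ∀ f, R f = ι (G f) := fun f => rfl
  have hRc : IsCompactOperator R := hι.comp_clm G
  have hRs : ∀ f g, ⟪R f, g⟫_ℝ = ⟪f, R g⟫_ℝ := fun f g => by
    rw [hR, hR, real_inner_comm, ← hG, ← hG, hT]
  have hAR : ∀ x z, (x, z) ∈ A.graph ↔ R (c₀ • x - z) = x := by
    intro x z
    rw [hA]
    constructor
    · rintro ⟨v, hv, h⟩
      rw [hR, ← hGuniq _ _ h, hv]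
    · intro h
      exact ⟨_, h, fun w => hG _ w⟩
  -- Single-valuedness of `A` enters here: `R f = 0` places `(0, -f)` in the graph.
  have hinj : ∀ f, R f = 0 → f = 0 := by
    intro f hf
    have h1 : ((0 : X), -f) ∈ A.graph := by
      rw [hAR, smul_zero, zero_sub, neg_neg, hf]
    exact neg_eq_zero.1 (A.graph_fst_eq_zero_snd h1 rfl)
  obtain ⟨K, b, ρ, hb⟩ := exists_hilbertBasis_eigenvectors R hRc hRs
  have hρ : ∀ k, 0 < ρ k := by
    intro k
    have h1 : 0 ≤ ρ k := by
      have h2 : ⟪R (b k), b k⟫_ℝ = ρ k := by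
        rw [hb, inner_smul_left, real_inner_self_eq_norm_sq, b.orthonormal.1 k]
        simp
      rw [← h2, hR, real_inner_comm, ← hG]
      exact le_trans (by positivity) (hcoer _)
    refine lt_of_le_of_ne h1 fun h0 => ?_
    have h3 := hinj (b k) (by rw [hb, ← h0, zero_smul])
    have h4 := b.orthonormal.1 k
    rw [h3, norm_zero] at h4
    exact zero_ne_one h4
  refine ⟨K, b, fun k => c₀ - (ρ k)⁻¹, ?_, ?_, ?_⟩
  · intro x z
    rw [hAR]
    have hcoord : ∀ k, ⟪b k, R (c₀ • x - z)⟫_ℝ = ρ k * (c₀ * ⟪b k, x⟫_ℝ - ⟪b k, z⟫_ℝ) := by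
      intro k
      rw [← hRs, hb, inner_smul_left, inner_sub_right, inner_smul_right]
      simp
    have hiff : R (c₀ • x - z) = x ↔ ∀ k, ⟪b k, R (c₀ • x - z)⟫_ℝ = ⟪b k, x⟫_ℝ :=
      ⟨fun h k => by rw [h], hilbertBasis_ext b⟩
    rw [hiff]
    refine forall_congr' fun k => ?_
    rw [hcoord, sub_mul, mul_comm (ρ k), ← eq_div_iff (hρ k).ne', div_eq_inv_mul]
    constructor <;> intro h <;> linarith
  · intro N
    have hε : 0 < (|c₀ - N| + 1)⁻¹ := by positivity
    refine (finite_eigenvalues_ge R hRc b hb hε).subset fun k hk => ?_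
    have hk' : N ≤ c₀ - (ρ k)⁻¹ := hk
    refine inv_le_of_inv_le₀ (hρ k) ?_
    linarith [le_abs_self (c₀ - N)]
  · intro x z hxz
    obtain ⟨v, rfl, h⟩ := (hA _ _).1 hxz
    refine ⟨v, rfl, by rw [← h]; exact hcoer v, fun w => ?_⟩
    rw [← h]
    exact (real_inner_le_norm _ _).trans
      (mul_le_mul_of_nonneg_right (T.le_opNorm v) (norm_nonneg w))

end Form

/-! ### The elliptic form -/

section Elliptic

variable {n : ℕ} {Ω : Set (E n)} (𝔞 : EllipticCoeffs Ω)

/-- The coefficient matrix at a point, as an operator. -/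
def EllipticCoeffs.matrixAt (ξ : E n) : E n →L[ℝ] E n :=
  ∑ i, ∑ j, 𝔞.a i j ξ •
    (EuclideanSpace.proj (𝕜 := ℝ) i : E n →L[ℝ] ℝ).smulRight (EuclideanSpace.single j (1 : ℝ))

lemma EllipticCoeffs.inner_matrixAt (ξ v w : E n) :
    ⟪𝔞.matrixAt ξ v, w⟫_ℝ = ∑ i, ∑ j, 𝔞.a i j ξ * v i * w j := by
  simp only [matrixAt, _root_.sum_apply, _root_.smul_apply, ContinuousLinearMap.smulRight_apply,
    sum_inner, inner_smul_left, EuclideanSpace.inner_single_left, conj_trivial, one_mul,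
    PiLp.proj_apply, mul_assoc]

lemma EllipticCoeffs.inner_matrixAt_comm (ξ v w : E n) :
    ⟪𝔞.matrixAt ξ v, w⟫_ℝ = ⟪𝔞.matrixAt ξ w, v⟫_ℝ := by
  rw [inner_matrixAt, inner_matrixAt, Finset.sum_comm]
  refine Finset.sum_congr rfl fun i _ => Finset.sum_congr rfl fun j _ => ?_
  rw [𝔞.symm j i]
  ring

lemma EllipticCoeffs.continuous_matrixAt : Continuous 𝔞.matrixAt :=
  continuous_finsetSum _ fun i _ => continuous_finsetSum _ fun j _ =>
    (𝔞.smooth_a i j).continuous.smul continuous_const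

lemma memLp_top_of_continuous {F : Type*} [NormedAddCommGroup F] (hΩm : MeasurableSet Ω)
    (hΩ : Bornology.IsBounded Ω) {f : E n → F} (hf : Continuous f) :
    MemLp f ⊤ (volume.restrict Ω) := by
  obtain ⟨c, hc⟩ := (hΩ.isCompact_closure).exists_bound_of_continuousOn hf.continuousOn
  refine memLp_top_of_bound hf.aestronglyMeasurable c ?_
  filter_upwards [ae_restrict_mem hΩm] with ξ hξ
  exact hc ξ (subset_closure hξ)

/-- Multiplication of vector fields by the coefficient matrix. -/
def EllipticCoeffs.matrixOp (hΩm : MeasurableSet Ω) (hΩ : Bornology.IsBounded Ω) :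
    L2Vec Ω →L[ℝ] L2Vec Ω :=
  (ContinuousLinearMap.id ℝ (E n →L[ℝ] E n)).holderL (volume.restrict Ω) ⊤ 2 2
    ((memLp_top_of_continuous hΩm hΩ 𝔞.continuous_matrixAt).toLp _)

lemma EllipticCoeffs.matrixOp_ae (hΩm : MeasurableSet Ω) (hΩ : Bornology.IsBounded Ω)
    (g : L2Vec Ω) : ∀ᵐ ξ ∂(volume.restrict Ω), 𝔞.matrixOp hΩm hΩ g ξ = 𝔞.matrixAt ξ (g ξ) := by
  filter_upwards [(ContinuousLinearMap.id ℝ (E n →L[ℝ] E n)).coeFn_holder (r := 2)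
    ((memLp_top_of_continuous hΩm hΩ 𝔞.continuous_matrixAt).toLp _) g,
    (memLp_top_of_continuous hΩm hΩ 𝔞.continuous_matrixAt).coeFn_toLp] with ξ e1 e2
  refine e1.trans ?_
  rw [e2]
  rfl

/-- Multiplication by `c₀ - c`. -/
def EllipticCoeffs.shiftOp (hΩm : MeasurableSet Ω) (hΩ : Bornology.IsBounded Ω) (c₀ : ℝ) :
    L2 Ω →L[ℝ] L2 Ω :=
  (ContinuousLinearMap.mul ℝ ℝ).holderL (volume.restrict Ω) ⊤ 2 2
    ((memLp_top_of_continuous hΩm hΩ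
      (continuous_const.sub 𝔞.smooth_c.continuous : Continuous fun ξ => c₀ - 𝔞.c ξ)).toLp _)

lemma EllipticCoeffs.shiftOp_ae (hΩm : MeasurableSet Ω) (hΩ : Bornology.IsBounded Ω) (c₀ : ℝ)
    (x : L2 Ω) : ∀ᵐ ξ ∂(volume.restrict Ω), 𝔞.shiftOp hΩm hΩ c₀ x ξ = (c₀ - 𝔞.c ξ) * x ξ := by
  have hc : Continuous fun ξ => c₀ - 𝔞.c ξ := continuous_const.sub 𝔞.smooth_c.continuous
  filter_upwards [(ContinuousLinearMap.mul ℝ ℝ).coeFn_holder (r := 2)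
    ((memLp_top_of_continuous hΩm hΩ hc).toLp _) x,
    (memLp_top_of_continuous hΩm hΩ hc).coeFn_toLp] with ξ e1 e2
  refine e1.trans ?_
  rw [e2]
  rfl

/-- The operator on `H¹₀(Ω)` of the form `∫ ∑ aᵢⱼ ∂ᵢv ∂ⱼw + ∫ (c₀ - c) v w`. -/
def EllipticCoeffs.formOp (hΩm : MeasurableSet Ω) (hΩ : Bornology.IsBounded Ω) (c₀ : ℝ) :
    energySpace Ω →L[ℝ] energySpace Ω :=
  (ContinuousLinearMap.adjoint (energyGrad Ω)).comp ((𝔞.matrixOp hΩm hΩ).comp (energyGrad Ω)) +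
    (ContinuousLinearMap.adjoint (energyFst Ω)).comp ((𝔞.shiftOp hΩm hΩ c₀).comp (energyFst Ω))

lemma EllipticCoeffs.inner_formOp (hΩm : MeasurableSet Ω) (hΩ : Bornology.IsBounded Ω) (c₀ : ℝ)
    (v w : energySpace Ω) : ⟪𝔞.formOp hΩm hΩ c₀ v, w⟫_ℝ =
      ⟪𝔞.matrixOp hΩm hΩ (energyGrad Ω v), energyGrad Ω w⟫_ℝ +
        ⟪𝔞.shiftOp hΩm hΩ c₀ (energyFst Ω v), energyFst Ω w⟫_ℝ := by
  rw [formOp, _root_.add_apply, inner_add_left, ContinuousLinearMap.comp_apply,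
    ContinuousLinearMap.comp_apply, ContinuousLinearMap.comp_apply,
    ContinuousLinearMap.comp_apply, ContinuousLinearMap.adjoint_inner_left,
    ContinuousLinearMap.adjoint_inner_left]

lemma EllipticCoeffs.inner_matrixOp_comm (hΩm : MeasurableSet Ω) (hΩ : Bornology.IsBounded Ω)
    (g g' : L2Vec Ω) : ⟪𝔞.matrixOp hΩm hΩ g, g'⟫_ℝ = ⟪𝔞.matrixOp hΩm hΩ g', g⟫_ℝ := by
  rw [L2.inner_def, L2.inner_def]
  refine integral_congr_ae ?_
  filter_upwards [𝔞.matrixOp_ae hΩm hΩ g, 𝔞.matrixOp_ae hΩm hΩ g'] with ξ e1 e2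
  rw [e1, e2, inner_matrixAt_comm]

lemma EllipticCoeffs.inner_shiftOp_comm (hΩm : MeasurableSet Ω) (hΩ : Bornology.IsBounded Ω)
    (c₀ : ℝ) (x x' : L2 Ω) :
    ⟪𝔞.shiftOp hΩm hΩ c₀ x, x'⟫_ℝ = ⟪𝔞.shiftOp hΩm hΩ c₀ x', x⟫_ℝ := by
  rw [L2.inner_def, L2.inner_def]
  refine integral_congr_ae ?_
  filter_upwards [𝔞.shiftOp_ae hΩm hΩ c₀ x, 𝔞.shiftOp_ae hΩm hΩ c₀ x'] with ξ e1 e2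
  rw [e1, e2]
  simp
  ring

lemma EllipticCoeffs.exists_coercive (hΩm : MeasurableSet Ω) (hΩ : Bornology.IsBounded Ω) :
    ∃ c₀ α : ℝ, 0 ≤ c₀ ∧ 0 < α ∧
      ∀ v : energySpace Ω, α * ‖v‖ ^ 2 ≤ ⟪𝔞.formOp hΩm hΩ c₀ v, v⟫_ℝ := by
  obtain ⟨α, hα, hell⟩ := 𝔞.elliptic
  obtain ⟨k, hk⟩ := (hΩ.isCompact_closure).exists_bound_of_continuousOn
    𝔞.smooth_c.continuous.continuousOn
  -- With `c ≤ |k|` on `Ω`, this shift makes `c₀ - c ≥ α`, so both halves of the norm are controlled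
  -- with the ellipticity constant.
  refine ⟨|k| + α, α, by positivity, hα, fun v => ?_⟩
  rw [inner_formOp, energySpace_norm_sq, mul_add, add_comm, ← real_inner_self_eq_norm_sq,
    ← real_inner_self_eq_norm_sq, ← real_inner_smul_left, ← real_inner_smul_left]
  simp only [L2.inner_def]
  refine add_le_add (integral_mono_ae (L2.integrable_inner _ _) (L2.integrable_inner _ _) ?_)
    (integral_mono_ae (L2.integrable_inner _ _) (L2.integrable_inner _ _) ?_)
  · filter_upwards [Lp.coeFn_smul α (energyGrad Ω v), 𝔞.matrixOp_ae hΩm hΩ (energyGrad Ω v),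
      ae_restrict_mem hΩm] with ξ e1 e2 hξ
    rw [e1, e2, inner_matrixAt, Pi.smul_apply, real_inner_smul_left, real_inner_self_eq_norm_sq,
      EuclideanSpace.norm_sq_eq]
    simpa using hell ξ hξ (energyGrad Ω v ξ)
  · filter_upwards [Lp.coeFn_smul α (energyFst Ω v),
      𝔞.shiftOp_ae hΩm hΩ (|k| + α) (energyFst Ω v), ae_restrict_mem hΩm] with ξ e1 e2 hξ
    rw [e1, e2, Pi.smul_apply, real_inner_smul_left]
    have h1 : 𝔞.c ξ ≤ |k| :=
      (le_abs_self _).trans ((hk ξ (subset_closure hξ)).trans (le_abs_self _))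
    simp only [RCLike.inner_apply, conj_trivial]
    nlinarith [mul_self_nonneg (energyFst Ω v ξ)]

lemma IsTest.exists_mem_testGraph {φ : E n → ℝ} (hφ : IsTest Ω φ) :
    ∃ p ∈ testGraph Ω, (p.1 : E n → ℝ) =ᵐ[volume.restrict Ω] φ ∧
      (p.2 : E n → E n) =ᵐ[volume.restrict Ω] gradient φ := by
  have m1 := (hφ.1.continuous.memLp_of_hasCompactSupport (μ := volume) (p := 2) hφ.2.1).restrict Ω
  have m2 := (hφ.continuous_gradient.memLp_of_hasCompactSupport (μ := volume) (p := 2)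
    hφ.hasCompactSupport_gradient).restrict Ω
  exact ⟨(m1.toLp _, m2.toLp _), ⟨φ, hφ, m1.coeFn_toLp, m2.coeFn_toLp⟩,
    m1.coeFn_toLp, m2.coeFn_toLp⟩

/-- The weak equation, tested with elements of `L²`. -/
lemma EllipticCoeffs.weakEq_iff (hΩm : MeasurableSet Ω) (hΩ : Bornology.IsBounded Ω) (c₀ : ℝ)
    (x : L2 Ω) (g : L2Vec Ω) (z : L2 Ω) : 𝔞.WeakEq x g z ↔ ∀ p ∈ testGraph Ω,
      ⟪𝔞.matrixOp hΩm hΩ g, p.2⟫_ℝ + ⟪𝔞.shiftOp hΩm hΩ c₀ x, p.1⟫_ℝ = ⟪c₀ • x - z, p.1⟫_ℝ := by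
  have key : ∀ (φ : E n → ℝ), IsTest Ω φ → ∀ p : L2 Ω × L2Vec Ω,
      (p.1 : E n → ℝ) =ᵐ[volume.restrict Ω] φ →
      (p.2 : E n → E n) =ᵐ[volume.restrict Ω] gradient φ →
      (⟪𝔞.matrixOp hΩm hΩ g, p.2⟫_ℝ + ⟪𝔞.shiftOp hΩm hΩ c₀ x, p.1⟫_ℝ - ⟪c₀ • x - z, p.1⟫_ℝ =
        (∫ ξ in Ω, z ξ * φ ξ) - ∫ ξ in Ω,
          (-(∑ i, ∑ j, 𝔞.a i j ξ * g ξ i * gradient φ ξ j) + 𝔞.c ξ * x ξ * φ ξ)) := by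
    intro φ hφ p h1 h2
    rw [L2.inner_def, L2.inner_def, L2.inner_def, ← integral_add (L2.integrable_inner _ _)
      (L2.integrable_inner _ _), ← integral_sub ((L2.integrable_inner _ _).add
      (L2.integrable_inner _ _)) (L2.integrable_inner _ _), ← integral_sub
      (integrable_mul_test _ (Lp.memLp z) φ hφ.1.continuous hφ.2.1) (𝔞.integrable_lhs x g hφ)]
    refine integral_congr_ae ?_
    filter_upwards [h1, h2, 𝔞.matrixOp_ae hΩm hΩ g, 𝔞.shiftOp_ae hΩm hΩ c₀ x,
      Lp.coeFn_sub (c₀ • x) z, Lp.coeFn_smul c₀ x] with ξ e1 e2 e3 e4 e5 e6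
    rw [e1, e2, e3, e4, e5, Pi.sub_apply, e6, Pi.smul_apply, inner_matrixAt]
    simp only [RCLike.inner_apply, conj_trivial, smul_eq_mul]
    ring
  constructor
  · rintro h p ⟨φ, hφ, h1, h2⟩
    have := key φ hφ p h1 h2
    rw [h φ hφ, sub_self] at this
    linarith
  · intro h φ hφ
    obtain ⟨p, hp, h1, h2⟩ := hφ.exists_mem_testGraph
    have := key φ hφ p h1 h2
    rw [h p hp, sub_self] at this
    linarith

/-- The variational form of `A`: both sides of the weak equation are continuous in the `H¹` norm of
the test pair, so it extends from test functions to all of `H¹₀(Ω)`. -/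
lemma EllipticCoeffs.mem_graph_op_iff (hΩo : IsOpen Ω) (hΩ : Bornology.IsBounded Ω) (c₀ : ℝ)
    (x z : L2 Ω) : (x, z) ∈ 𝔞.op.graph ↔ ∃ v, energyFst Ω v = x ∧
      ∀ w, ⟪𝔞.formOp hΩo.measurableSet hΩ c₀ v, w⟫_ℝ = ⟪c₀ • x - z, energyFst Ω w⟫_ℝ := by
  rw [op, Submodule.toLinearPMap_graph_eq _ (𝔞.graph_singleValued hΩo)]
  constructor
  · rintro ⟨g, hg, h⟩
    obtain ⟨v, hv1, hv2⟩ := exists_energySpace hg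
    simp only at hv1 hv2
    refine ⟨v, hv1, fun w => ?_⟩
    rw [inner_formOp, hv1, hv2]
    have hcl : IsClosed {p : L2 Ω × L2Vec Ω | ⟪𝔞.matrixOp hΩo.measurableSet hΩ g, p.2⟫_ℝ +
        ⟪𝔞.shiftOp hΩo.measurableSet hΩ c₀ x, p.1⟫_ℝ = ⟪c₀ • x - z, p.1⟫_ℝ} :=
      isClosed_eq (by fun_prop) (by fun_prop)
    exact closure_minimal (s := (testGraph Ω : Set (L2 Ω × L2Vec Ω)))
      ((𝔞.weakEq_iff hΩo.measurableSet hΩ c₀ x g z).1 h) hcl (energySpace_mem w)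
  · rintro ⟨v, rfl, h⟩
    refine ⟨energyGrad Ω v, energySpace_mem v,
      (𝔞.weakEq_iff hΩo.measurableSet hΩ c₀ _ _ z).2 fun p hp => ?_⟩
    obtain ⟨w, hw1, hw2⟩ := exists_energySpace ((testGraph Ω).le_topologicalClosure hp)
    have := h w
    rwa [inner_formOp, hw1, hw2] at this

/-- The Dirichlet operator `A` is diagonal, with eigenvalues tending to `-∞`. -/
theorem EllipticCoeffs.exists_isDiagonal (hΩo : IsOpen Ω) (hΩ : Bornology.IsBounded Ω) :
    ∃ (K : Type) (b : HilbertBasis K ℝ (L2 Ω)) (lam : K → ℝ) (c₀ α β : ℝ),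
      0 ≤ c₀ ∧ 0 < α ∧ 0 ≤ β ∧ IsDiagonal 𝔞.op b lam ∧ (∀ N, {k | N ≤ lam k}.Finite) ∧
      HasEnergy 𝔞.op (energyFst Ω) c₀ α β := by
  obtain ⟨c₀, α, hc₀, hα, hcoer⟩ := 𝔞.exists_coercive hΩo.measurableSet hΩ
  obtain ⟨K, b, lam, h1, h2, h3⟩ := exists_isDiagonal_of_form
    (isCompactOperator_energyFst hΩo.measurableSet hΩ)
    (fun v w => by
      rw [inner_formOp, inner_formOp, inner_matrixOp_comm, inner_shiftOp_comm])
    hα hcoer (𝔞.mem_graph_op_iff hΩo hΩ c₀)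
  exact ⟨K, b, lam, c₀, α, _, hc₀, hα, ContinuousLinearMap.opNorm_nonneg _, h1, h2, h3⟩

end Elliptic

/-! ### Weak gradients -/

section WeakGradient

variable {n : ℕ} {Ω ω : Set (E n)}

lemma HasWeakGradientOn.exists_restrict (hΩm : MeasurableSet Ω) (hωΩ : ω ⊆ Ω) {x : L2 Ω}
    {g : L2Vec Ω} (h : HasWeakGradientOn Ω x g) :
    ∃ g' : L2Vec ω, ‖g'‖ ≤ ‖g‖ ∧ HasWeakGradientOn ω x g' := by
  have hle : volume.restrict ω ≤ volume.restrict Ω := Measure.restrict_mono hωΩ le_rfl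
  have hm : MemLp g 2 (volume.restrict ω) := (Lp.memLp g).mono_measure hle
  refine ⟨hm.toLp _, ?_, fun φ hφ => ?_⟩
  · rw [Lp.norm_toLp, Lp.norm_def]
    exact ENNReal.toReal_mono (Lp.eLpNorm_ne_top g) (eLpNorm_mono_measure _ hle)
  · have hφz : ∀ ξ ∉ ω, φ ξ = 0 := fun ξ hξ => by
      by_contra hne
      exact hξ (hφ.2.2 (subset_tsupport _ hne))
    have hgz : ∀ ξ ∉ ω, gradient φ ξ = 0 := fun ξ hξ => by
      have : fderiv ℝ φ ξ = 0 := by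
        by_contra hne
        exact hξ (hφ.2.2 (tsupport_fderiv_subset ℝ (subset_tsupport _ hne)))
      simp [gradient, this]
    have h1 := h φ ⟨hφ.1, hφ.2.1, hφ.2.2.trans hωΩ⟩
    rw [setIntegral_eq_of_subset_of_forall_sdiff_eq_zero hΩm hωΩ fun ξ hξ => by
        rw [hgz ξ hξ.2, smul_zero],
      setIntegral_eq_of_subset_of_forall_sdiff_eq_zero hΩm hωΩ fun ξ hξ => by
        rw [hφz ξ hξ.2, zero_smul]] at h1
    rw [h1]
    congr 1
    refine integral_congr_ae ?_
    filter_upwards [hm.coeFn_toLp] with ξ e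
    rw [e]

lemma IsTest.memLp {φ : E n → ℝ} (hφ : IsTest Ω φ) : MemLp φ 2 (volume.restrict Ω) :=
  (hφ.1.continuous.memLp_of_hasCompactSupport hφ.2.1).restrict Ω

lemma IsTest.memLp_gradient {φ : E n → ℝ} (hφ : IsTest Ω φ) :
    MemLp (gradient φ) 2 (volume.restrict Ω) :=
  (hφ.continuous_gradient.memLp_of_hasCompactSupport hφ.hasCompactSupport_gradient).restrict Ω

lemma integrable_smul_of_memLp {f : E n → ℝ} {g : E n → E n}
    (hf : MemLp f 2 (volume.restrict Ω)) (hg : MemLp g 2 (volume.restrict Ω)) :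
    Integrable (fun ξ => f ξ • g ξ) (volume.restrict Ω) :=
  memLp_one_iff_integrable.1 (hg.smul hf)

lemma hasWeakGradientOn_of_mem_h10Graph {p : L2 Ω × L2Vec Ω} (hp : p ∈ h10Graph Ω) :
    HasWeakGradientOn Ω p.1 p.2 := by
  intro φ hφ
  have i1 := integrable_smul_of_memLp (Lp.memLp p.1) hφ.memLp_gradient
  have i2 := integrable_smul_of_memLp hφ.memLp (Lp.memLp p.2)
  rw [eq_neg_iff_add_eq_zero, ← integral_add i1 i2]
  ext i
  have h1 := (EuclideanSpace.proj (𝕜 := ℝ) i : E n →L[ℝ] ℝ).integral_comp_comm (i1.add i2)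
  have h2 := weak_of_mem_h10Graph hφ i p hp
  refine h1.symm.trans (Eq.trans (integral_congr_ae (ae_of_all _ fun ξ => ?_)) h2)
  simp [mul_comm]

lemma hasWeakGradientOn_energySpace (v : energySpace Ω) :
    HasWeakGradientOn Ω (energyFst Ω v) (energyGrad Ω v) :=
  hasWeakGradientOn_of_mem_h10Graph (energySpace_mem v)

/-- If `e^{μ t} x`, with `μ ≥ 0`, has weak gradients tending to `0`, then `∇ x = 0`. -/
lemma hasWeakGradientOn_zero_of_tendsto (hωΩ : ω ⊆ Ω) {x : L2 Ω} {μ : ℝ} (hμ : 0 ≤ μ)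
    {g : ℝ≥0 → L2Vec ω}
    (hg : ∀ t : ℝ≥0, HasWeakGradientOn ω (Real.exp (μ * t) • x : L2 Ω) (g t))
    (hlim : Tendsto (fun t => ‖g t‖) atTop (𝓝 0)) : HasWeakGradientOn ω x fun _ => 0 := by
  intro φ hφ
  simp only [smul_zero, integral_zero, neg_zero]
  let L : L2Vec ω →L[ℝ] E n :=
    (ContinuousLinearMap.lsmul ℝ ℝ).lpPairing (volume.restrict ω) 2 2 (hφ.memLp.toLp φ)
  have hL : ∀ g : L2Vec ω, L g = ∫ ξ in ω, φ ξ • g ξ := by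
    intro g
    refine (ContinuousLinearMap.lpPairing_eq_integral _ _ _).trans (integral_congr_ae ?_)
    filter_upwards [hφ.memLp.coeFn_toLp] with ξ e
    rw [e]
    rfl
  have h0 : Tendsto (fun t => L (g t)) atTop (𝓝 0) := by
    have := (L.continuous.tendsto 0).comp (tendsto_zero_iff_norm_tendsto_zero.2 hlim)
    rwa [map_zero] at this
  -- The left side does not depend on `t`: the factor `e^{μt} ≥ 1` is dropped. The right side tends
  -- to zero.
  have hle : ∀ t : ℝ≥0, ‖∫ ξ in ω, x ξ • gradient φ ξ‖ ≤ ‖L (g t)‖ := by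
    intro t
    have h1 := hg t φ hφ
    have h2 : ∫ ξ in ω, (Real.exp (μ * t) • x : L2 Ω) ξ • gradient φ ξ =
        Real.exp (μ * t) • ∫ ξ in ω, x ξ • gradient φ ξ := by
      rw [← integral_smul]
      refine integral_congr_ae ?_
      filter_upwards [ae_mono (Measure.restrict_mono hωΩ le_rfl)
        (Lp.coeFn_smul (Real.exp (μ * t)) x)] with ξ e
      rw [e, Pi.smul_apply, smul_assoc]
    rw [hL, ← norm_neg (∫ ξ in ω, φ ξ • g t ξ), ← h1, h2, norm_smul, Real.norm_eq_abs,
      abs_of_pos (Real.exp_pos _)]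
    exact le_mul_of_one_le_left (norm_nonneg _) (Real.one_le_exp (by positivity))
  have h3 := ge_of_tendsto' h0.norm hle
  rw [norm_zero] at h3
  exact norm_le_zero_iff.1 h3

end WeakGradient

/-! ### Detectability -/

section Detectability

variable {n : ℕ} {Ω ω : Set (E n)} {𝔞 : EllipticCoeffs Ω} {q : ℕ}
  {C : 𝔞.op.domain →ₗ[ℝ] (Fin q → ℝ)}

lemma HasEnergy.exists_lift {c₀ α β : ℝ} (hE : HasEnergy 𝔞.op (energyFst Ω) c₀ α β)
    (x : 𝔞.op.domain) : ∃ v, energyFst Ω v = x := by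
  obtain ⟨v, hv, -⟩ := hE _ _ (𝔞.op.mem_graph x)
  exact ⟨v, hv⟩

/-- An eigenvector that the output does not see is unaffected by any feedback. -/
lemma closedLoop_eigenvector {H : (Fin q → ℝ) →L[ℝ] L2 Ω} {x : 𝔞.op.domain} {μ : ℝ}
    (hx : 𝔞.op x = μ • (x : L2 Ω)) (hCx : C x = 0) :
    ((x : L2 Ω), μ • (x : L2 Ω)) ∈ (closedLoop 𝔞.op C H).graph :=
  mem_graph_closedLoop.2 ⟨x.2, by rw [Subtype.coe_eta, hCx, map_zero, sub_zero, hx]⟩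

lemma IsAsympGradDetectable.gradient_eq_zero (hωΩ : ω ⊆ Ω) (h : IsAsympGradDetectable ω 𝔞.op C)
    {x : 𝔞.op.domain} {v : energySpace Ω} (hv : energyFst Ω v = x) {μ : ℝ} (hμ : 0 ≤ μ)
    (hx : 𝔞.op x = μ • (x : L2 Ω)) (hCx : C x = 0) :
    HasWeakGradientOn ω (x : L2 Ω) fun _ => 0 := by
  obtain ⟨H, S, hS, hstab⟩ := h
  obtain ⟨g, hg, hlim⟩ := hstab x ⟨energyGrad Ω v, hv ▸ hasWeakGradientOn_energySpace v⟩
  refine hasWeakGradientOn_zero_of_tendsto hωΩ hμ (fun t => ?_) hlim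
  rw [← hS.apply_eigenvector (closedLoop_eigenvector hx hCx) t]
  exact hg t

lemma IsExpGradDetectable.gradient_eq_zero (hωΩ : ω ⊆ Ω) (h : IsExpGradDetectable ω 𝔞.op C)
    {x : 𝔞.op.domain} {v : energySpace Ω} (hv : energyFst Ω v = x) {μ : ℝ} (hμ : 0 ≤ μ)
    (hx : 𝔞.op x = μ • (x : L2 Ω)) (hCx : C x = 0) :
    HasWeakGradientOn ω (x : L2 Ω) fun _ => 0 := by
  obtain ⟨H, S, hS, M, γ, hM, hγ, hstab⟩ := h
  obtain ⟨g, hg, hle⟩ := hstab _ (energySpace_mem v)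
  refine hasWeakGradientOn_zero_of_tendsto hωΩ hμ (g := g) (fun t => ?_) ?_
  · rw [← hS.apply_eigenvector (closedLoop_eigenvector hx hCx) t, ← hv]
    exact hg t
  · refine squeeze_zero (fun t => norm_nonneg _) hle ?_
    have h1 : Tendsto (fun t : ℝ≥0 => Real.exp (-γ * t)) atTop (𝓝 0) :=
      Real.tendsto_exp_atBot.comp
        ((NNReal.tendsto_coe_atTop.2 tendsto_id).const_mul_atTop_of_neg (neg_neg_of_pos hγ))
    simpa using (h1.const_mul M).mul_const (Real.sqrt (‖energyFst Ω v‖ ^ 2 + ‖energyGrad Ω v‖ ^ 2))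

/-- Detectability from the Hautus test on the unstable eigenspaces. -/
theorem detectable_of_hautus (hΩ : IsOpen Ω) (hΩb : Bornology.IsBounded Ω) (hωΩ : ω ⊆ Ω)
    (hC : ∃ c : ℝ, ∀ x : 𝔞.op.domain, ‖C x‖ ≤ c * (‖(x : L2 Ω)‖ + ‖𝔞.op x‖))
    (hautus : ∀ (μ : ℝ) (x : 𝔞.op.domain), 0 ≤ μ → 𝔞.op x = μ • (x : L2 Ω) → C x = 0 → x = 0) :
    IsAsympGradDetectable ω 𝔞.op C ∧ IsExpGradDetectable ω 𝔞.op C := by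
  obtain ⟨K, b, lam, c₀, α, β, hc₀, hα, hβ, hA, hfin, hE⟩ := 𝔞.exists_isDiagonal hΩ hΩb
  obtain ⟨H, S, hS, M, γ, hM, hγ, hdec, hsm⟩ :=
    hA.exists_stabilizing_feedback hfin hC hautus hE hα hβ hc₀
  have hgrad : ∀ v : energySpace Ω, ∃ g : L2Vec ω, ‖g‖ ≤ ‖v‖ ∧
      HasWeakGradientOn ω (energyFst Ω v) g := by
    intro v
    obtain ⟨g, h1, h2⟩ :=
      (hasWeakGradientOn_energySpace v).exists_restrict hΩ.measurableSet hωΩ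
    refine ⟨g, h1.trans (le_of_sq_le_sq ?_ (norm_nonneg v)), h2⟩
    rw [energySpace_norm_sq v]
    linarith [sq_nonneg ‖energyFst Ω v‖]
  have hS0 : ∀ x, S 0 x = x := fun x => by rw [hS.1.map_zero, ContinuousLinearMap.id_apply]
  -- One feedback serves both notions. The first uses smoothing, since `x₀ ∈ H¹(Ω)` need not lie in
  -- `H¹₀(Ω)`; time `0` is separate because the smoothing bound is singular there. In the second, `M
  -- + 1` makes the constant at least `1`, as time `0` requires.
  refine ⟨⟨H, S, hS, fun x₀ hx₀ => ?_⟩, ⟨H, S, hS, M + 1, γ, by positivity, hγ, fun p hp => ?_⟩⟩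
  · have hex : ∀ t : ℝ≥0, ∃ g : L2Vec ω, HasWeakGradientOn ω (S t x₀) g ∧
        (0 < t → ‖g‖ ^ 2 ≤ M * (1 + 1 / t) * Real.exp (-γ * t) * ‖x₀‖ ^ 2) := by
      intro t
      rcases eq_or_ne t 0 with rfl | ht
      · obtain ⟨g₀, hg₀⟩ := hx₀
        obtain ⟨g, -, hg⟩ := hg₀.exists_restrict hΩ.measurableSet hωΩ
        exact ⟨g, by rwa [hS0], fun h => absurd h (lt_irrefl _)⟩
      · obtain ⟨v, hv, hle⟩ := hsm t (pos_iff_ne_zero.2 ht) x₀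
        obtain ⟨g, h1, h2⟩ := hgrad v
        exact ⟨g, hv ▸ h2, fun _ => (pow_le_pow_left₀ (norm_nonneg _) h1 2).trans hle⟩
    choose g hg hle using hex
    refine ⟨g, hg, ?_⟩
    have h1 : Tendsto (fun t : ℝ≥0 => Real.exp (-γ * t)) atTop (𝓝 0) :=
      Real.tendsto_exp_atBot.comp
        ((NNReal.tendsto_coe_atTop.2 tendsto_id).const_mul_atTop_of_neg (neg_neg_of_pos hγ))
    have h2 : Tendsto (fun t : ℝ≥0 => M * 2 * Real.exp (-γ * t) * ‖x₀‖ ^ 2) atTop (𝓝 0) := by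
      simpa using (h1.const_mul (M * 2)).mul_const (‖x₀‖ ^ 2)
    have h3 : Tendsto (fun t => ‖g t‖ ^ 2) atTop (𝓝 0) := by
      refine squeeze_zero' (Eventually.of_forall fun t => sq_nonneg _) ?_ h2
      filter_upwards [eventually_ge_atTop 1] with t ht
      have ht' : (1 : ℝ) ≤ t := by exact_mod_cast ht
      refine (hle t (one_pos.trans_le ht)).trans ?_
      have : 1 + 1 / (t : ℝ) ≤ 2 := by
        have : 1 / (t : ℝ) ≤ 1 := (div_le_one (by linarith)).2 ht'
        linarith
      gcongr
    simpa [Real.sqrt_sq] using h3.sqrt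
  · obtain ⟨v, hv1, hv2⟩ := exists_energySpace hp
    have hnorm : Real.sqrt (‖p.1‖ ^ 2 + ‖p.2‖ ^ 2) = ‖v‖ := by
      rw [← hv1, ← hv2, ← energySpace_norm_sq, Real.sqrt_sq (norm_nonneg v)]
    have hex : ∀ t : ℝ≥0, ∃ g : L2Vec ω, HasWeakGradientOn ω (S t p.1) g ∧
        ‖g‖ ≤ (M + 1) * Real.exp (-γ * t) * Real.sqrt (‖p.1‖ ^ 2 + ‖p.2‖ ^ 2) := by
      intro t
      rw [hnorm]
      have hv0 := norm_nonneg v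
      rcases eq_or_ne t 0 with rfl | ht
      · obtain ⟨g, h1, h2⟩ := hgrad v
        refine ⟨g, by rwa [hS0, ← hv1], h1.trans ?_⟩
        simp only [NNReal.coe_zero, mul_zero, Real.exp_zero, mul_one]
        exact le_mul_of_one_le_left hv0 (by linarith)
      · obtain ⟨v', hv', hle⟩ := hdec t (pos_iff_ne_zero.2 ht) v
        obtain ⟨g, h1, h2⟩ := hgrad v'
        refine ⟨g, by rwa [← hv1, ← hv'], h1.trans (hle.trans ?_)⟩
        gcongr
        linarith
    choose g hg hle using hex
    exact ⟨g, hg, hle⟩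

end Detectability

/-! ### The rank condition -/

section Rank

open scoped Matrix

lemma rank_eq_iff_mulVec_injective {q k : ℕ} (G : Matrix (Fin q) (Fin k) ℝ) :
    G.rank = k ↔ ∀ v, G *ᵥ v = 0 → v = 0 := by
  have h := G.mulVecLin.finrank_range_add_finrank_ker
  rw [Module.finrank_fin_fun] at h
  rw [← Matrix.ker_mulVecLin_eq_bot_iff, ← Submodule.finrank_eq_zero, Matrix.rank]
  omega

variable {X : Type*} [NormedAddCommGroup X] [NormedSpace ℝ X] {A : X →ₗ.[ℝ] X} {q : ℕ}
  {C : A.domain →ₗ[ℝ] (Fin q → ℝ)}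

lemma sensorMatrix_mulVec {k : ℕ} (ψ : Fin k → A.domain) (v : Fin k → ℝ) :
    sensorMatrix C ψ *ᵥ v = C (∑ j, v j • ψ j) := by
  funext i
  change ∑ j, C (ψ j) i * v j = _
  simp only [map_sum, map_smul, Finset.sum_apply, Pi.smul_apply, smul_eq_mul, mul_comm]

variable {J : ℕ} {lam : Fin J → ℝ} {r : Fin J → ℕ} {ψ : (m : Fin J) → Fin (r m) → A.domain}

lemma IsUnstableEigensystem.nonneg (hψ : IsUnstableEigensystem A lam r ψ) (m : Fin J) :
    0 ≤ lam m := ((hψ.mem_iff (lam m)).2 ⟨m, rfl⟩).1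

lemma IsUnstableEigensystem.apply_sum (hψ : IsUnstableEigensystem A lam r ψ) (m : Fin J)
    (v : Fin (r m) → ℝ) :
    A (∑ j, v j • ψ m j) = lam m • ((∑ j, v j • ψ m j : A.domain) : X) := by
  rw [← LinearPMap.toFun_eq_coe, map_sum]
  simp only [map_smul, LinearPMap.toFun_eq_coe, hψ.eigen, Submodule.coe_sum, Submodule.coe_smul,
    Finset.smul_sum]
  exact Finset.sum_congr rfl fun j _ => smul_comm _ _ _

/-- The rank conditions imply the Hautus test. -/
lemma IsUnstableEigensystem.hautus (hψ : IsUnstableEigensystem A lam r ψ)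
    (hrank : ∀ m, (sensorMatrix C (ψ m)).rank = r m) (μ : ℝ) (x : A.domain) (hμ : 0 ≤ μ)
    (hx : A x = μ • (x : X)) (hCx : C x = 0) : x = 0 := by
  by_contra hne
  obtain ⟨m, rfl⟩ := (hψ.mem_iff μ).1 ⟨hμ, x, hne, hx⟩
  obtain ⟨v, rfl⟩ := (Submodule.mem_span_range_iff_exists_fun ℝ).1 (hψ.span m x hx)
  have hv := (rank_eq_iff_mulVec_injective _).1 (hrank m) v (by rw [sensorMatrix_mulVec, hCx])
  exact hne (by simp [hv])

/-- The condition `q ≥ r` follows from the rank conditions, because a rank is at most the number of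
rows. -/
lemma sup_le_of_rank_eq (hrank : ∀ m, (sensorMatrix C (ψ m)).rank = r m) :
    Finset.univ.sup r ≤ q :=
  Finset.sup_le fun m _ => (hrank m).symm.le.trans (Matrix.rank_le_height _)

end Rank

end RegionalGradient

end

/-! ### The equivalence of both notions of detectability with the rank conditions. -/

theorem theorem3p10 {n : ℕ} (hn : 1 ≤ n)
    {Ω ω : Set (RegionalGradient.E n)} (hΩ : RegionalGradient.IsSmoothBoundedDomain Ω)
    (hω : IsOpen ω) (hωne : ω.Nonempty) (hωΩ : ω ⊆ Ω)
    (𝔞 : RegionalGradient.EllipticCoeffs Ω)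
    {q : ℕ} (s : Fin q → RegionalGradient.Sensor n) (hs : ∀ i, (s i).Admissible Ω)
    (C : 𝔞.op.domain →ₗ[ℝ] (Fin q → ℝ)) (hC : RegionalGradient.IsOutputOperator 𝔞.op s C)
    {J : ℕ} (lam : Fin J → ℝ) (r : Fin J → ℕ) (ψ : (m : Fin J) → Fin (r m) → 𝔞.op.domain)
    (hψ : RegionalGradient.IsUnstableEigensystem 𝔞.op lam r ψ)
    (hgrad : ∀ m, RegionalGradient.GradLinearIndependentOn ω
      (fun j => (ψ m j : RegionalGradient.L2 Ω))) :
    (RegionalGradient.IsAsympGradDetectable ω 𝔞.op C ↔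
      Finset.univ.sup r ≤ q ∧ ∀ m, (RegionalGradient.sensorMatrix C (ψ m)).rank = r m) ∧
    (RegionalGradient.IsExpGradDetectable ω 𝔞.op C ↔
      Finset.univ.sup r ≤ q ∧ ∀ m, (RegionalGradient.sensorMatrix C (ψ m)).rank = r m) := by
  obtain ⟨K, b, lam', c₀, α, β, hc₀, hα, hβ, hA, hfin, hE⟩ :=
    𝔞.exists_isDiagonal hΩ.isOpen hΩ.isBounded
  -- The common core of both necessity proofs: a kernel vector of `G_m` gives a combination whose
  -- gradient vanishes on `ω`, hence is zero by `hgrad`.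
  have hnec : (∀ (μ : ℝ) (x : 𝔞.op.domain), 0 ≤ μ → 𝔞.op x = μ • (x : RegionalGradient.L2 Ω) →
      C x = 0 → RegionalGradient.HasWeakGradientOn ω (x : RegionalGradient.L2 Ω) fun _ => 0) →
      Finset.univ.sup r ≤ q ∧ ∀ m, (RegionalGradient.sensorMatrix C (ψ m)).rank = r m := by
    intro h
    have hrank : ∀ m, (RegionalGradient.sensorMatrix C (ψ m)).rank = r m := fun m =>
      (RegionalGradient.rank_eq_iff_mulVec_injective _).2 fun v hv => by
        refine hgrad m v ?_
        have := h (lam m) (∑ j, v j • ψ m j) (hψ.nonneg m) (hψ.apply_sum m v)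
          (by rw [← RegionalGradient.sensorMatrix_mulVec, hv])
        simpa only [Submodule.coe_sum, Submodule.coe_smul] using this
    exact ⟨RegionalGradient.sup_le_of_rank_eq hrank, hrank⟩
  have hsuff : (∀ m, (RegionalGradient.sensorMatrix C (ψ m)).rank = r m) →
      RegionalGradient.IsAsympGradDetectable ω 𝔞.op C ∧
        RegionalGradient.IsExpGradDetectable ω 𝔞.op C := fun hrank =>
    RegionalGradient.detectable_of_hautus hΩ.isOpen hΩ.isBounded hωΩ hC.2 (hψ.hautus hrank)
  refine ⟨⟨fun h => hnec fun μ x hμ hx hCx => ?_, fun h => (hsuff h.2).1⟩,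
    ⟨fun h => hnec fun μ x hμ hx hCx => ?_, fun h => (hsuff h.2).2⟩⟩
  · obtain ⟨v, hv⟩ := hE.exists_lift x
    exact h.gradient_eq_zero hωΩ hv hμ hx hCx
  · obtain ⟨v, hv⟩ := hE.exists_lift x
    exact h.gradient_eq_zero hωΩ hv hμ hx hCx
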